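/- Equip $\mathbb C^4$ with the symplectic form $dz^1\wedge dz^3+dz^2\wedge dz^4$, let $\mathrm{Sp}(2,\mathbb C)$ be its symplectic group, $\mathbb Q_3$ the complex threefold of Lagrangian $2$-planes of $\mathbb C^4$, and $\mathrm{Sp}(2,\mathbb C)\to\mathbb Q_3$, $A\mapsto[A_1\wedge A_2]$ (the span of the first two columns) the natural holomorphic principal bundle. For a holomorphic map $A$ into $\mathrm{Sp}(2,\mathbb C)$ write $A^{-1}dA=(\varphi^j_i)$, so that $dA_i=\sum_j\varphi^j_iA_j$. An isotropic curve is a nonconstant holomorphic map $f:S\to\mathbb Q_3$ from a connected Riemann surface such that $\varphi^3_1\varphi^4_2-(\varphi^4_1)^2=0$ for every local holomorphic lift $A$ of $f$ to $\mathrm{Sp}(2,\mathbb C)$, and such that $f(S)$ is not contained in a null ray, i.e. no line of $\mathbb C^4$ is contained in all the planes $f(p)$. An adapted frame of $f$ on an open set $U\subset S$ is a holomorphic lift $A:U\to\mathrm{Sp}(2,\mathbb C)$ of $f|_U$ with $$\varphi^3_1=\varphi^4_1=\varphi^2_1-\varphi^4_2=\varphi^1_1-3\varphi^2_2=4\varphi^1_2-3\varphi^2_4=\varphi^1_4=0,\qquad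 \varphi^4_2\ne0\ \text{everywhere on } U.$$ Adapted frames exist locally off a discrete closed subset of $S$. The meromorphic quartic differential $\delta=\delta_f$ on $S$ is defined by $\delta=\varphi^1_3(\varphi^4_2)^3$ for every adapted frame, and $f$ is of general type if $\delta\not\equiv0$. The (meromorphic) projective structure of $f$ is given by the Cartan connection $$\eta=\begin{pmatrix}\varphi^2_2&-(3/32)^{1/3}\varphi^2_4\\-6^{-1/3}\varphi^4_2&-\varphi^2_2\end{pmatrix};$$ its projective charts are the complex charts $(U,z)$ of $S$ for which there is an adapted frame on $U$ with $\eta=\begin{pmatrix}0&0\\dz&0\end{pmatrix}$. Let $f:S\to\mathbb Q_3$ and $\hat f:\hat S\to\mathbb Q_3$ be two isotropic curves of general type, with quartic differentials $\delta$ and $\hat\delta$. A holomorphic map $h:\hat S\to S$ is called projective if, whenever $(\hat U,\hat z)$ and $(U,z)$ are projective charts of $\hat f$ and $f$ and $p\in\hat U$, $h(p)\in U$, there is a Möbius transformation $m$ with $z\circ h=m\circ\hat z$ near $p$. The curve $\hat f$ is dominated by $f$ if there are a holomorphic map $h:\hat S\to S$ and $X\in\mathrm{Sp}(2,\mathbb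 C)$ with $\hat f=X\cdot(f\circ h)$. Corollary. $\hat f$ is dominated by $f$ if and only if there exists a projective map $h:\hat S\to S$ such that $h^*\delta=\hat\delta$ (as meromorphic differentials, i.e. off a discrete closed subset of $\hat S$). -/

import Mathlib

open scoped Manifold ContDiff Topology Matrix

noncomputable section

namespace IsotropicCurves

/-- Indices of `ℂ⁴`: the indices `1, 2, 3, 4` are `inl 0, inl 1, inr 0, inr 1`. -/
abbrev Idx : Type := Fin 2 ⊕ Fin 2

abbrev i1 : Idx := Sum.inl 0
abbrev i2 : Idx := Sum.inl 1
abbrev i3 : Idx := Sum.inr 0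
abbrev i4 : Idx := Sum.inr 1

/-- The space `ℂ⁴`. -/
abbrev C4 : Type := Idx → ℂ

/-- The symplectic form `dz¹ ∧ dz³ + dz² ∧ dz⁴` on `ℂ⁴`. -/
def sympForm (x y : C4) : ℂ :=
  (x i1 * y i3 - x i3 * y i1) + (x i2 * y i4 - x i4 * y i2)

/-- The complex symplectic group `Sp(2, ℂ)`, consisting of `4 × 4` matrices. -/
abbrev Sp2C : Type := Matrix.symplecticGroup (Fin 2) ℂ

/-- The points of `ℚ₃`: the Lagrangian 2-planes of `ℂ⁴`. -/
@[ext]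
structure Q3 where
  plane : Submodule ℂ C4
  finrank_eq : Module.finrank ℂ plane = 2
  isotropic : ∀ x ∈ plane, ∀ y ∈ plane, sympForm x y = 0

theorem sympForm_eq (x y : C4) : sympForm x y = - (x ⬝ᵥ (Matrix.J (Fin 2) ℂ *ᵥ y)) := by
  simp [sympForm, Matrix.J, dotProduct, Matrix.mulVec, Matrix.fromBlocks, Matrix.one_apply]
  ring

/-- Symplectic matrices preserve the symplectic form. -/
theorem sympForm_mulVec (X : Sp2C) (x y : C4) :
    sympForm (X.1 *ᵥ x) (X.1 *ᵥ y) = sympForm x y := by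
  have h : (X.1)ᵀ * (Matrix.J (Fin 2) ℂ * X.1) = Matrix.J (Fin 2) ℂ := by
    rw [← Matrix.mul_assoc]
    exact SymplecticGroup.mem_iff'.1 X.2
  rw [sympForm_eq, sympForm_eq, dotProduct_comm, dotProduct_comm x]
  conv_rhs => rw [← h]
  rw [← Matrix.mulVec_mulVec, ← Matrix.mulVec_mulVec, Matrix.dotProduct_mulVec,
    Matrix.mulVec_transpose]

/-- The action of `Sp(2, ℂ)` on the Lagrangian 2-planes: `X • P` is the image of `P` under `X`. -/
instance : SMul Sp2C Q3 where
  smul X P :=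
    { plane := P.plane.map (Matrix.mulVecLin X.1)
      finrank_eq := by
        have hinj : Function.Injective (Matrix.mulVecLin X.1) :=
          Matrix.mulVec_injective_iff_isUnit.2
            ((Matrix.isUnit_iff_isUnit_det _).2 (SymplecticGroup.symplectic_det X.2))
        exact (Submodule.equivMapOfInjective _ hinj P.plane).finrank_eq.symm.trans P.finrank_eq
      isotropic := by
        rintro _ ⟨x, hx, rfl⟩ _ ⟨y, hy, rfl⟩
        simpa only [Matrix.mulVecLin_apply, sympForm_mulVec] using P.isotropic x hx y hy }

section Curves

variable {S : Type*} [TopologicalSpace S] [ChartedSpace ℂ S]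

/-- `A : U → Sp(2, ℂ)` is a symplectic frame along `f` on the open set `U`: it is holomorphic
and `f = [A₁ ∧ A₂]` on `U`. (Values of `A` outside `U` are irrelevant.) -/
structure IsSymplecticFrame (f : S → Q3) (U : Set S) (A : S → Sp2C) : Prop where
  isOpen : IsOpen U
  holomorphic : ∀ i j : Idx, MDifferentiableOn 𝓘(ℂ) 𝓘(ℂ) (fun p => (A p).1 i j) U
  lift : ∀ p ∈ U, (f p).plane = Submodule.span ℂ {(A p).1.col i1, (A p).1.col i2}

/-- The pull-back `A⁻¹ dA` of the Maurer-Cartan form by a map `A : S → Sp(2, ℂ)`, evaluated at a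
tangent vector. The form `φ^j_i`, defined by `dA_i = φ^j_i A_j`, is the entry `(j, i)`: upper
indices are rows. -/
def mcForm (A : S → Sp2C) (p : S) (v : TangentSpace 𝓘(ℂ) p) : Matrix Idx Idx ℂ :=
  (A p).1⁻¹ * Matrix.of fun i j =>
    (mfderiv 𝓘(ℂ) 𝓘(ℂ) (fun q => (A q).1 i j) p v : ℂ)

/-- An isotropic curve `f : S → ℚ₃`. The complex structure of `ℚ₃` is that for which
`Sp(2, ℂ) → ℚ₃`, `A ↦ [A₁ ∧ A₂]`, is a holomorphic principal bundle; hence `f` is holomorphic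
when it locally has symplectic frames. The pull-back by `f` of the conformal structure of `ℚ₃`
is represented by `φ³₁ φ⁴₂ - (φ⁴₁)²` in any symplectic frame along `f`. -/
structure IsIsotropicCurve (f : S → Q3) : Prop where
  holomorphic : ∀ p : S, ∃ U A, p ∈ U ∧ IsSymplecticFrame f U A
  nonconstant : ∃ p q : S, f p ≠ f q
  isotropic : ∀ U A, IsSymplecticFrame f U A → ∀ p ∈ U, ∀ v : TangentSpace 𝓘(ℂ) p,
    mcForm A p v i3 i1 * mcForm A p v i4 i2 - (mcForm A p v i4 i1) ^ 2 = 0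
  /-- The curve is not contained in a null ray, the pencil of all planes through a line. -/
  not_null_ray : ¬ ∃ ξ : C4, ξ ≠ 0 ∧ ∀ p, ξ ∈ (f p).plane

/-- `A` is a local holomorphic section over `U` of the canonical reduced bundle `𝓕` of `f`, which
lives over the complement of the critical points of `f` and of its Legendre associate. -/
structure IsAdaptedFrame (f : S → Q3) (U : Set S) (A : S → Sp2C) : Prop
    extends IsSymplecticFrame f U A where
  pfaff31 : ∀ p ∈ U, ∀ v : TangentSpace 𝓘(ℂ) p, mcForm A p v i3 i1 = 0
  pfaff41 : ∀ p ∈ U, ∀ v : TangentSpace 𝓘(ℂ) p, mcForm A p v i4 i1 = 0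
  pfaff21 : ∀ p ∈ U, ∀ v : TangentSpace 𝓘(ℂ) p, mcForm A p v i2 i1 - mcForm A p v i4 i2 = 0
  pfaff11 : ∀ p ∈ U, ∀ v : TangentSpace 𝓘(ℂ) p, mcForm A p v i1 i1 - 3 * mcForm A p v i2 i2 = 0
  pfaff12 : ∀ p ∈ U, ∀ v : TangentSpace 𝓘(ℂ) p,
    4 * mcForm A p v i1 i2 - 3 * mcForm A p v i2 i4 = 0
  pfaff14 : ∀ p ∈ U, ∀ v : TangentSpace 𝓘(ℂ) p, mcForm A p v i1 i4 = 0
  pfaff42 : ∀ p ∈ U, ∀ v : TangentSpace 𝓘(ℂ) p, v ≠ 0 → mcForm A p v i4 i2 ≠ 0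

open Classical in
/-- The quartic differential `δ` of `f`, as a function on tangent vectors, homogeneous of degree
four on each tangent space: `δ = φ¹₃ (φ⁴₂)³` in any local section of the reduced bundle. It is
meromorphic on `S`; at the isolated points over which the reduced bundle has no local section it
is given the value `0`, so it is to be compared with other meromorphic differentials off a
discrete set. -/
def quarticDiff (f : S → Q3) (p : S) (v : TangentSpace 𝓘(ℂ) p) : ℂ :=
  if h : ∃ UA : Set S × (S → Sp2C), p ∈ UA.1 ∧ IsAdaptedFrame f UA.1 UA.2 then
    mcForm h.choose.2 p v i1 i3 * (mcForm h.choose.2 p v i4 i2) ^ 3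
  else 0

/-- A curve is of general type if its quartic differential does not vanish identically. -/
def IsGeneralType (f : S → Q3) : Prop :=
  ∃ p : S, ∃ v : TangentSpace 𝓘(ℂ) p, quarticDiff f p v ≠ 0

/-- The pull-back by a local section `A` of the reduced bundle of the `𝔰𝔩(2, ℂ)`-valued Cartan
connection `η` which defines the projective structure of an isotropic curve. -/
def cartanForm (A : S → Sp2C) (p : S) (v : TangentSpace 𝓘(ℂ) p) : Matrix (Fin 2) (Fin 2) ℂ :=
  !![mcForm A p v i2 i2, -(((3 / 32 : ℝ) ^ (1 / 3 : ℝ) : ℝ) : ℂ) * mcForm A p v i2 i4;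
     -(((6 : ℝ) ^ (-(1 / 3) : ℝ) : ℝ) : ℂ) * mcForm A p v i4 i2, -mcForm A p v i2 i2]

/-- `(U, z)` is a chart of the projective structure of `f`: it is a complex chart (an injective
holomorphic function on the open set `U`) and there is a section of the reduced bundle over `U`
along which the Cartan connection is `dz` times the elementary matrix in position `(2, 1)`. -/
structure IsProjectiveChart (f : S → Q3) (U : Set S) (z : S → ℂ) : Prop where
  isOpen : IsOpen U
  holomorphic : MDifferentiableOn 𝓘(ℂ) 𝓘(ℂ) z U
  injective : Set.InjOn z U
  flat : ∃ A, IsAdaptedFrame f U A ∧ ∀ p ∈ U, ∀ v : TangentSpace 𝓘(ℂ) p,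
    cartanForm A p v = !![0, 0; (mfderiv 𝓘(ℂ) 𝓘(ℂ) z p v : ℂ), 0]

end Curves

section TwoCurves

variable {S : Type*} [TopologicalSpace S] [ChartedSpace ℂ S]
  {S' : Type*} [TopologicalSpace S'] [ChartedSpace ℂ S']

/-- `f'` is dominated by `f`: `f' = X · (f ∘ h)` with `h` holomorphic and `X ∈ Sp(2, ℂ)`. -/
def IsDominatedBy (f' : S' → Q3) (f : S → Q3) : Prop :=
  ∃ h : S' → S, MDifferentiable 𝓘(ℂ) 𝓘(ℂ) h ∧ ∃ X : Sp2C, ∀ p, f' p = X • f (h p)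

/-- `h : S' → S` is a projective map for the (meromorphic) projective structures of `f'` and `f`:
it is holomorphic and, in charts of the two projective structures, it is locally the restriction
of a Möbius transformation. -/
structure IsProjectiveMap (f' : S' → Q3) (f : S → Q3) (h : S' → S) : Prop where
  holomorphic : MDifferentiable 𝓘(ℂ) 𝓘(ℂ) h
  moebius : ∀ U' z' U z, IsProjectiveChart f' U' z' → IsProjectiveChart f U z →
    ∀ p ∈ U', h p ∈ U → ∃ a b c d : ℂ, a * d - b * c ≠ 0 ∧
      ∀ᶠ q in 𝓝 p, c * z' q + d ≠ 0 ∧ z (h q) = (a * z' q + b) / (c * z' q + d)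

/-- The pull-back `h^* δ_f` of the quartic differential. -/
def pullbackQuarticDiff (f : S → Q3) (h : S' → S) (p : S') (v : TangentSpace 𝓘(ℂ) p) : ℂ :=
  quarticDiff f (h p) (mfderiv 𝓘(ℂ) 𝓘(ℂ) h p v)

end TwoCurves

end IsotropicCurves

end

/-!
Along an adapted frame, `A⁻¹ dA` has only four independent coefficients `α = φ²₂`, `β = φ²₄`,
`γ = φ¹₃`, `θ = φ⁴₂` (`IsAdaptedFrame.mcForm_eq`). Here `α, β, θ` form an `𝔰𝔩(2, ℂ)`-connection,
embedded by the irreducible four-dimensional representation, and `γ` is the remaining invariant.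
Differentiating the relations between two adapted frames along the same curve shows that they
differ by the image of an upper triangular matrix of `SL(2, ℂ)` (`gauge_rigidity`). Hence `γ θ³` is
well defined (`IsAdaptedFrame.quarticDiff_eq`). If both frames are flat, with `α = β = 0` and `θ` a
constant multiple of the differential of a coordinate, then the diagonal parameter `t` of the change
of frames is an affine function of the first coordinate, and the second coordinate, whose derivative
is `t⁻²`, is a Möbius transformation of the first (`FrameODE.moebius`).

If `f' = X • (f ∘ h)`, left translates of pull-backs of adapted frames of `f` satisfy the structure
equations for `f'`, so that `h` is projective (`isProjectiveMap_of_dominated`). A nonconstant `h` is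
an immersion off a discrete closed set (`eventually_immersion_of_nonconstant`), and where it is an
immersion it pulls back `δ` to `δ'` (`quarticDiff_eq_of_dominated`).

Conversely, let `h` be projective with `h^* δ = δ'`. Near a point at which `δ'` does not vanish,
both `f'` and, at the image point, `f` have adapted frames, hence flat ones: a flat frame is found
by solving a linear differential equation (`FrameODE.exists_flat`). As `h` is a Möbius
transformation in the projective charts, the pulled back frame of `f` can be changed so that it is
flat with respect to the coordinate of `f'`. Then `α, β, θ` agree for the two frames, and `γ` does
because the quartic differentials agree. So the frames differ by a constant symplectic matrix `X`
(`FrameODE.congruent`), `f' = X • (f ∘ h)` near the point (`eventually_congruent`), and everywhere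
by the identity principle (`eq_of_eventually_eq`).
-/

noncomputable section

namespace IsotropicCurves

/-! ### Differentiation of matrix-valued functions -/

/-- `P'` is the derivative at `x` of the matrix-valued function `P`, entry by entry. -/
def HasMatDerivAt (P : ℂ → Matrix Idx Idx ℂ) (P' : Matrix Idx Idx ℂ) (x : ℂ) : Prop :=
  ∀ i j, HasDerivAt (fun y => P y i j) (P' i j) x

theorem HasMatDerivAt.mul {P Q : ℂ → Matrix Idx Idx ℂ} {P' Q' : Matrix Idx Idx ℂ} {x : ℂ}
    (hP : HasMatDerivAt P P' x) (hQ : HasMatDerivAt Q Q' x) :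
    HasMatDerivAt (fun y => P y * Q y) (P' * Q x + P x * Q') x := by
  intro i j
  simp only [Matrix.mul_apply, Matrix.add_apply, ← Finset.sum_add_distrib]
  exact HasDerivAt.fun_sum fun k _ => (hP i k).mul (hQ k j)

theorem HasMatDerivAt.transpose {P : ℂ → Matrix Idx Idx ℂ} {P' : Matrix Idx Idx ℂ} {x : ℂ}
    (hP : HasMatDerivAt P P' x) : HasMatDerivAt (fun y => (P y)ᵀ) P'ᵀ x :=
  fun i j => hP j i

theorem hasMatDerivAt_const (C : Matrix Idx Idx ℂ) (x : ℂ) :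
    HasMatDerivAt (fun _ => C) 0 x := fun i j => hasDerivAt_const x (C i j)

theorem HasMatDerivAt.unique {P : ℂ → Matrix Idx Idx ℂ} {P' P'' : Matrix Idx Idx ℂ} {x : ℂ}
    (h : HasMatDerivAt P P' x) (h' : HasMatDerivAt P P'' x) : P' = P'' := by
  ext i j
  exact (h i j).unique (h' i j)

theorem HasMatDerivAt.congr {P Q : ℂ → Matrix Idx Idx ℂ} {P' : Matrix Idx Idx ℂ} {x : ℂ}
    (h : HasMatDerivAt P P' x) (hQ : Q =ᶠ[𝓝 x] P) : HasMatDerivAt Q P' x :=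
  fun i j => (h i j).congr_of_eventuallyEq (hQ.fun_comp fun M : Matrix Idx Idx ℂ => M i j)

theorem Sp2C.inv_mul (A : Sp2C) : A.1⁻¹ * A.1 = 1 :=
  Matrix.nonsing_inv_mul _ (SymplecticGroup.symplectic_det A.2)

theorem Sp2C.mul_inv (A : Sp2C) : A.1 * A.1⁻¹ = 1 :=
  Matrix.mul_nonsing_inv _ (SymplecticGroup.symplectic_det A.2)

/-- The inverse of a symplectic matrix is polynomial in its entries, hence differentiable. -/
theorem HasMatDerivAt.inv {P : ℂ → Sp2C} {Φ : Matrix Idx Idx ℂ} {x : ℂ}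
    (hP : HasMatDerivAt (fun y => (P y).1) ((P x).1 * Φ) x) :
    HasMatDerivAt (fun y => (P y).1⁻¹) (-(Φ * (P x).1⁻¹)) x := by
  have h1 : ∀ y, (P y).1⁻¹ = (-Matrix.J (Fin 2) ℂ) * (P y).1ᵀ * Matrix.J (Fin 2) ℂ := fun y => by
    rw [← SymplecticGroup.coe_inv', SymplecticGroup.coe_inv]
  obtain ⟨D, hD⟩ : ∃ D, HasMatDerivAt (fun y => (P y).1⁻¹) D x := by
    simp only [h1]
    exact ⟨_, ((hasMatDerivAt_const _ x).mul hP.transpose).mul (hasMatDerivAt_const _ x)⟩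
  have h2 := hD.mul hP
  simp only [Sp2C.inv_mul] at h2
  have h3 := h2.unique (hasMatDerivAt_const 1 x)
  rw [← Matrix.mul_assoc, Sp2C.inv_mul, Matrix.one_mul] at h3
  have h4 : D = -(Φ * (P x).1⁻¹) := by
    have := congrArg (· * (P x).1⁻¹) h3
    simp only [Matrix.add_mul, Matrix.mul_assoc, Sp2C.mul_inv, Matrix.mul_one,
      Matrix.zero_mul] at this
    exact eq_neg_of_add_eq_zero_left this
  rwa [h4] at hD

/-! ### The structure equations and the structure group -/

/-- The value of `A⁻¹ dA` along an adapted frame `A`, in terms of `α = φ²₂`, `β = φ²₄`,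
`γ = φ¹₃` and `θ = φ⁴₂`. -/
def adaptedForm (α β γ θ : ℂ) : Matrix Idx Idx ℂ :=
  Matrix.fromBlocks !![3 * α, 3 / 4 * β; θ, α] !![γ, 0; 0, β] !![0, 0; 0, θ]
    !![-(3 * α), -θ; -(3 / 4 * β), -α]

/-- The elements of the structure group of the bundle of adapted frames: the image of the upper
triangular subgroup under the irreducible four-dimensional representation of `SL(2, ℂ)`. The
parameter `t` is the eigenvalue of `diag (t, t⁻¹)`, and `u` is the entry in position `(1, 2)`, which
together with `t` determines the unipotent part. -/
def gaugeMat (t u : ℂ) : Matrix Idx Idx ℂ :=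
  Matrix.fromBlocks !![t ^ 3, u; 0, t]
    !![-(2 / 9) * u ^ 3 / t ^ 6, 2 / 3 * u ^ 2 / t ^ 3;
       -(2 / 3) * u ^ 2 / t ^ 5, 4 / 3 * u / t ^ 2]
    0 !![1 / t ^ 3, 0; -u / t ^ 4, 1 / t]

theorem gaugeMat_mem {t : ℂ} (ht : t ≠ 0) (u : ℂ) :
    gaugeMat t u ∈ Matrix.symplecticGroup (Fin 2) ℂ := by
  rw [SymplecticGroup.mem_iff']
  ext i j
  rcases i with i | i <;> rcases j with j | j <;> fin_cases i <;> fin_cases j <;>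
    simp [gaugeMat, Matrix.J, Matrix.fromBlocks_multiply, Matrix.fromBlocks_transpose,
      Matrix.mul_apply, Fin.sum_univ_two] <;> field_simp <;> ring

/-- Transformation of `A⁻¹ dA` under a change `G` of adapted frames, in the form
`dG = G φ' - φ G`. The hypotheses on the derivatives of `t` and `u` determine the new coefficients
`α'` and `β'`; the new coefficients `γ'` and `θ'` are algebraic in `t`. -/
theorem hasMatDerivAt_gaugeMat {t u : ℂ → ℂ} {α β γ θ α' β' x : ℂ} (h0 : t x ≠ 0)
    (ht : HasDerivAt t (α' * t x + θ * u x / 3 - α * t x) x)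
    (hu : HasDerivAt u (3 / 4 * β' * t x ^ 3 + α' * u x + 2 / 3 * θ * u x ^ 2 / t x
      - 3 * α * u x - 3 / 4 * β * t x) x) :
    HasMatDerivAt (fun y => gaugeMat (t y) (u y))
      (gaugeMat (t x) (u x) * adaptedForm α' β' (γ / t x ^ 6) (t x ^ 2 * θ)
        - adaptedForm α β γ θ * gaugeMat (t x) (u x)) x := by
  have d1 := ht.pow 3
  have d2 := ((hu.pow 3).const_mul (-(2 / 9))).div (ht.pow 6) (pow_ne_zero 6 h0)
  have d3 := ((hu.pow 2).const_mul (2 / 3)).div (ht.pow 3) (pow_ne_zero 3 h0)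
  have d4 := ((hu.pow 2).const_mul (-(2 / 3))).div (ht.pow 5) (pow_ne_zero 5 h0)
  have d5 := (hu.const_mul (4 / 3)).div (ht.pow 2) (pow_ne_zero 2 h0)
  have d6 := (hasDerivAt_const x (1 : ℂ)).div (ht.pow 3) (pow_ne_zero 3 h0)
  have d7 := hu.neg.div (ht.pow 4) (pow_ne_zero 4 h0)
  have d8 := (hasDerivAt_const x (1 : ℂ)).div ht h0
  have d0 := hasDerivAt_const x (0 : ℂ)
  intro i j
  rcases i with i | i <;> rcases j with j | j <;> fin_cases i <;> fin_cases j <;>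
    [refine HasDerivAt.congr_deriv d1 ?_; refine HasDerivAt.congr_deriv hu ?_;
     refine HasDerivAt.congr_deriv d0 ?_; refine HasDerivAt.congr_deriv ht ?_;
     refine HasDerivAt.congr_deriv d2 ?_; refine HasDerivAt.congr_deriv d3 ?_;
     refine HasDerivAt.congr_deriv d4 ?_; refine HasDerivAt.congr_deriv d5 ?_;
     refine HasDerivAt.congr_deriv d0 ?_; refine HasDerivAt.congr_deriv d0 ?_;
     refine HasDerivAt.congr_deriv d0 ?_; refine HasDerivAt.congr_deriv d0 ?_;
     refine HasDerivAt.congr_deriv d6 ?_; refine HasDerivAt.congr_deriv d0 ?_;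
     refine HasDerivAt.congr_deriv d7 ?_; refine HasDerivAt.congr_deriv d8 ?_] <;>
    simp [gaugeMat, adaptedForm, Matrix.fromBlocks_multiply] <;> field_simp <;> ring

/-! ### Changes of adapted frames -/

/-- The differential equations and the symplectic relations satisfied by the entries of a block
triangular change of adapted frames determine all entries by `t = G²₂` and `u = G¹₂`: each
algebraic relation between the entries is differentiated to obtain the next one. -/
theorem gauge_entries {V : Set ℂ} (hV : IsOpen V) {s t u p q y z m r n : ℂ → ℂ}
    {α β γ θ α' β' γ' θ' : ℂ → ℂ}
    (hsm : ∀ x ∈ V, s x * m x = 1) (htn : ∀ x ∈ V, t x * n x = 1)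
    (hr : ∀ x ∈ V, u x * m x + t x * r x = 0)
    (hq : ∀ x ∈ V, q x * n x - m x * y x - r x * z x = 0)
    (hθ : ∀ x ∈ V, θ x ≠ 0) (hn : ∀ x ∈ V, θ' x * n x = θ x * t x)
    (hst : ∀ x ∈ V, θ' x * t x = θ x * s x)
    (ds : ∀ x ∈ V, HasDerivAt s (3 * α' x * s x + θ' x * u x - 3 * α x * s x) x)
    (dt : ∀ x ∈ V, HasDerivAt t (α' x * t x + θ' x * z x - θ x * u x - α x * t x) x)
    (du : ∀ x ∈ V, HasDerivAt u (3 / 4 * β' x * s x + α' x * u x + θ' x * y x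
      - 3 * α x * u x - 3 / 4 * β x * t x) x)
    (dz : ∀ x ∈ V, HasDerivAt z (β' x * t x - θ' x * q x - α' x * z x
      - θ x * y x - α x * z x - β x * n x) x)
    (dy : ∀ x ∈ V, HasDerivAt y (β' x * u x - θ' x * p x - α' x * y x
      - 3 * α x * y x - 3 / 4 * β x * z x) x)
    (dp : ∀ x ∈ V, HasDerivAt p (γ' x * s x - 3 * α' x * p x - 3 / 4 * β' x * y x
      - 3 * α x * p x - 3 / 4 * β x * q x - γ x * m x) x) {x : ℂ} (hx : x ∈ V) :
    t x ≠ 0 ∧ θ' x = t x ^ 2 * θ x ∧ s x = t x ^ 3 ∧ m x = 1 / t x ^ 3 ∧ n x = 1 / t x ∧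
    r x = -u x / t x ^ 4 ∧ z x = 4 / 3 * u x / t x ^ 2 ∧ y x = 2 / 3 * u x ^ 2 / t x ^ 3 ∧
    q x = -(2 / 3) * u x ^ 2 / t x ^ 5 ∧ p x = -(2 / 9) * u x ^ 3 / t x ^ 6 ∧
    γ x = γ' x * t x ^ 6 := by
  -- algebraic consequences of the relations
  have ht : ∀ x ∈ V, t x ≠ 0 := fun x hx => left_ne_zero_of_mul_eq_one (htn x hx)
  have hn' : ∀ x ∈ V, n x = 1 / t x := fun x hx => by
    have := ht x hx
    field_simp
    linear_combination htn x hx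
  have hθ' : ∀ x ∈ V, θ' x = t x ^ 2 * θ x := fun x hx => by
    linear_combination (t x) * hn x hx - θ' x * htn x hx
  have hs : ∀ x ∈ V, s x = t x ^ 3 := fun x hx => by
    have := hst x hx
    rw [hθ' x hx] at this
    exact mul_left_cancel₀ (hθ x hx) (by linear_combination -this)
  have hm : ∀ x ∈ V, m x = 1 / t x ^ 3 := fun x hx => by
    have h1 := hsm x hx
    have := ht x hx
    rw [hs x hx] at h1
    field_simp
    linear_combination h1
  have hr' : ∀ x ∈ V, r x = -u x / t x ^ 4 := fun x hx => by
    have h1 := hr x hx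
    have := ht x hx
    rw [hm x hx] at h1
    field_simp at h1 ⊢
    linear_combination h1
  have ev : ∀ {F G : ℂ → ℂ}, (∀ x ∈ V, F x = G x) → ∀ x ∈ V, G =ᶠ[𝓝 x] F := fun h x hx => by
    filter_upwards [hV.mem_nhds hx] with w hw using (h w hw).symm
  -- the derivative of `s = t ^ 3`
  have hz : ∀ x ∈ V, z x = 4 / 3 * u x / t x ^ 2 := fun x hx => by
    have h1 := (ds x hx).unique ((((dt x hx).pow 3)).congr_of_eventuallyEq (ev hs x hx).symm)
    have := ht x hx
    have := hθ x hx
    simp only [hs x hx, hθ' x hx] at h1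
    field_simp at h1 ⊢
    push_cast at h1
    have h2 : t x ^ 2 * θ x * (4 * u x - 3 * t x ^ 2 * z x) = 0 := by linear_combination h1
    have h3 : 4 * u x - 3 * t x ^ 2 * z x = 0 := 
      (mul_eq_zero.1 h2).resolve_left (mul_ne_zero (pow_ne_zero 2 (ht x hx)) (hθ x hx))
    linear_combination -h3
  have hq' : ∀ x ∈ V, q x = y x / t x ^ 2 - 4 / 3 * u x ^ 2 / t x ^ 5 := fun x hx => by
    have h1 := hq x hx
    have := ht x hx
    rw [hm x hx, hn' x hx, hr' x hx, hz x hx] at h1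
    field_simp at h1 ⊢
    linear_combination h1
  -- the derivative of the formula for `z`
  have hy : ∀ x ∈ V, y x = 2 / 3 * u x ^ 2 / t x ^ 3 := fun x hx => by
    have h0 := ht x hx
    have h1 := (dz x hx).unique ((((du x hx).const_mul (4 / 3)).div ((dt x hx).pow 2)
      (pow_ne_zero 2 h0)).congr_of_eventuallyEq (ev hz x hx).symm)
    have := hθ x hx
    simp only [hs x hx, hθ' x hx, hz x hx, hq' x hx, hn' x hx, Pi.pow_apply] at h1
    field_simp at h1 ⊢
    push_cast at h1
    exact mul_left_cancel₀ (mul_ne_zero h0 this) (by linear_combination (-1 / 10) * h1)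
  have hq'' : ∀ x ∈ V, q x = -(2 / 3) * u x ^ 2 / t x ^ 5 := fun x hx => by
    have := ht x hx
    rw [hq' x hx, hy x hx]
    field_simp
    ring
  -- the derivative of the formula for `y`
  have hp : ∀ x ∈ V, p x = -(2 / 9) * u x ^ 3 / t x ^ 6 := fun x hx => by
    have h0 := ht x hx
    have h1 := (dy x hx).unique (((((du x hx).pow 2).const_mul (2 / 3)).div ((dt x hx).pow 3)
      (pow_ne_zero 3 h0)).congr_of_eventuallyEq (ev hy x hx).symm)
    have := hθ x hx
    simp only [hs x hx, hθ' x hx, hz x hx, hy x hx, Pi.pow_apply] at h1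
    field_simp at h1 ⊢
    push_cast at h1
    exact mul_left_cancel₀ (mul_ne_zero (pow_ne_zero 2 h0) this)
      (by linear_combination (-1 / 4) * h1)
  -- the derivative of the formula for `p`
  have hγ : ∀ x ∈ V, γ x = γ' x * t x ^ 6 := fun x hx => by
    have h0 := ht x hx
    have h1 := (dp x hx).unique (((((du x hx).pow 3).const_mul (-(2 / 9))).div ((dt x hx).pow 6)
      (pow_ne_zero 6 h0)).congr_of_eventuallyEq (ev hp x hx).symm)
    have := hθ x hx
    simp only [hs x hx, hθ' x hx, hz x hx, hq'' x hx, hy x hx, hm x hx, hp x hx, Pi.pow_apply] at h1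
    field_simp at h1 ⊢
    push_cast at h1
    exact mul_left_cancel₀ (pow_ne_zero 9 h0) (by linear_combination (-1 / 108) * h1)
  exact ⟨ht x hx, hθ' x hx, hs x hx, hm x hx, hn' x hx, hr' x hx, hz x hx, hy x hx, hq'' x hx,
    hp x hx, hγ x hx⟩

/-- A holomorphic change of adapted frames takes values in the structure group `gaugeMat t u`, and
`θ`, `γ` are multiplied by `t²`, `t⁻⁶`. Here `α, β, γ, θ` may have zeros: only the new frame is
assumed to satisfy `θ' ≠ 0`. -/
theorem gauge_rigidity {V : Set ℂ} (hV : IsOpen V) {G : ℂ → Matrix Idx Idx ℂ}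
    {α β γ θ α' β' γ' θ' : ℂ → ℂ}
    (hG : ∀ x ∈ V, G x ∈ Matrix.symplecticGroup (Fin 2) ℂ)
    (hblock : ∀ x ∈ V, ∀ i j, G x (Sum.inr i) (Sum.inl j) = 0)
    (hθ' : ∀ x ∈ V, θ' x ≠ 0)
    (hd : ∀ x ∈ V, HasMatDerivAt G (G x * adaptedForm (α' x) (β' x) (γ' x) (θ' x)
      - adaptedForm (α x) (β x) (γ x) (θ x) * G x) x) :
    ∃ t u : ℂ → ℂ, ∀ x ∈ V, t x ≠ 0 ∧ G x = gaugeMat (t x) (u x) ∧ θ' x = t x ^ 2 * θ x ∧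
    γ x = γ' x * t x ^ 6 ∧
    HasDerivAt t (α' x * t x + θ x * u x / 3 - α x * t x) x ∧
    HasDerivAt u (3 / 4 * β' x * t x ^ 3 + α' x * u x + 2 / 3 * θ x * u x ^ 2 / t x
      - 3 * α x * u x - 3 / 4 * β x * t x) x := by
  have b1 := fun y hy => hblock y hy 0 0
  have b2 := fun y hy => hblock y hy 0 1
  have b3 := fun y hy => hblock y hy 1 0
  have b4 := fun y hy => hblock y hy 1 1
  have sp : ∀ i j, ∀ y ∈ V, ((G y)ᵀ * Matrix.J (Fin 2) ℂ * G y) i j = Matrix.J (Fin 2) ℂ i j :=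
    fun i j y hy => by rw [SymplecticGroup.mem_iff'.1 (hG y hy)]
  -- equations between entries come from differentiating entries which vanish identically
  have zero : ∀ {F : ℂ → ℂ} {F' y : ℂ}, (∀ y ∈ V, F y = 0) → y ∈ V →
      HasDerivAt F F' y → F' = 0 :=
    fun {F F' y} hF hy h => h.unique ((hasDerivAt_const y (0 : ℂ)).congr_of_eventuallyEq
      (Filter.eventually_of_mem (hV.mem_nhds hy) hF))
  have e1 := fun y hy => hd y hy i2 i1
  have e2 := fun y hy => zero b4 hy (hd y hy i4 i2)
  have e3 := fun y hy => zero b2 hy (hd y hy i3 i2)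
  have s13 := sp i1 i3
  have s14 := sp i1 i4
  have s23 := sp i2 i3
  have s24 := sp i2 i4
  have s34 := sp i3 i4
  have f1 := fun y hy => hd y hy i1 i1
  have f2 := fun y hy => hd y hy i2 i2
  have f3 := fun y hy => hd y hy i1 i2
  have f5 := fun y hy => hd y hy i2 i4
  have f6 := fun y hy => hd y hy i1 i4
  have f7 := fun y hy => hd y hy i1 i3
  clear hd sp
  simp only [Matrix.mul_apply, Matrix.J, adaptedForm, Fintype.sum_sum_type, Fin.sum_univ_two,
    Matrix.sub_apply, Matrix.transpose_apply, Matrix.fromBlocks_apply₁₁, Matrix.fromBlocks_apply₁₂,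
    Matrix.fromBlocks_apply₂₁, Matrix.fromBlocks_apply₂₂, Matrix.of_apply, Matrix.cons_val_zero,
    Matrix.cons_val_one, Matrix.cons_val', Matrix.cons_val_fin_one, Matrix.zero_apply,
    Matrix.neg_apply, Matrix.one_apply_eq, Matrix.one_apply_ne zero_ne_one,
    Matrix.one_apply_ne one_ne_zero] at e1 e2 e3 s13 s14 s23 s24 s34 f1 f2 f3 f5 f6 f7
  have g34 : ∀ y ∈ V, G y (Sum.inr 0) (Sum.inr 1) = 0 := fun y hy => by
    have h := e3 y hy
    simp only [b1 y hy, b2 y hy, b4 y hy] at h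
    simpa [hθ' y hy] using h
  have htn : ∀ y ∈ V, G y (Sum.inl 1) (Sum.inl 1) * G y (Sum.inr 1) (Sum.inr 1) = 1 :=
    fun y hy => by
      have h := s24 y hy
      simp only [b2 y hy, b4 y hy, g34 y hy] at h
      linear_combination -h
  have g21 : ∀ y ∈ V, G y (Sum.inl 1) (Sum.inl 0) = 0 := fun y hy => by
    have h := s14 y hy
    simp only [b1 y hy, b3 y hy, g34 y hy] at h
    linear_combination (-G y (Sum.inl 1) (Sum.inl 1)) * h -
      G y (Sum.inl 1) (Sum.inl 0) * htn y hy
  have hn : ∀ y ∈ V, θ' y * G y (Sum.inr 1) (Sum.inr 1) = θ y * G y (Sum.inl 1) (Sum.inl 1) :=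
    fun y hy => by
      have h := e2 y hy
      simp only [b2 y hy, b3 y hy, b4 y hy] at h
      linear_combination h
  have hθ : ∀ y ∈ V, θ y ≠ 0 := fun y hy h0 => by
    have h := hn y hy
    have h2 := htn y hy
    rw [h0, zero_mul] at h
    have := (mul_eq_zero.1 h).resolve_left (hθ' y hy)
    simp [this] at h2
  refine ⟨fun y => G y i2 i2, fun y => G y i1 i2, fun x hx => ?_⟩
  have key := gauge_entries hV (s := fun y => G y i1 i1) (t := fun y => G y i2 i2)
    (u := fun y => G y i1 i2) (p := fun y => G y i1 i3) (q := fun y => G y i2 i3)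
    (y := fun y => G y i1 i4) (z := fun y => G y i2 i4) (m := fun y => G y i3 i3)
    (r := fun y => G y i4 i3) (n := fun y => G y i4 i4) (α := α) (β := β) (γ := γ) (θ := θ)
    (α' := α') (β' := β') (γ' := γ') (θ' := θ')
    (fun y hy => by
      have h := s13 y hy
      simp only [b1 y hy, b3 y hy, g21 y hy] at h
      linear_combination -h) htn
    (fun y hy => by
      have h := s23 y hy
      simp only [b2 y hy, b4 y hy] at h
      linear_combination -h)
    (fun y hy => by
      have h := s34 y hy
      simp only [g34 y hy] at h
      linear_combination -h) hθ hn
    (fun y hy => by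
      have h := zero g21 hy (e1 y hy)
      simp only [b3 y hy, g21 y hy] at h
      linear_combination h)
    (fun y hy => (f1 y hy).congr_deriv (by
      simp only [b1 y hy, g21 y hy]
      ring))
    (fun y hy => (f2 y hy).congr_deriv (by
      simp only [b4 y hy, g21 y hy]
      ring))
    (fun y hy => (f3 y hy).congr_deriv (by
      simp only [b2 y hy]
      ring))
    (fun y hy => (f5 y hy).congr_deriv (by
      ring))
    (fun y hy => (f6 y hy).congr_deriv (by
      simp only [g34 y hy]
      ring))
    (fun y hy => (f7 y hy).congr_deriv (by
      ring)) hx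
  obtain ⟨ht, h1, h2, h3, h4, h5, h6, h7, h8, h9, h10⟩ := key
  refine ⟨ht, ?_, h1, h10, ?_, ?_⟩
  · ext i j
    rcases i with i | i <;> rcases j with j | j <;> fin_cases i <;> fin_cases j <;>
      simp only [gaugeMat, Matrix.fromBlocks_apply₁₁, Matrix.fromBlocks_apply₁₂,
        Matrix.fromBlocks_apply₂₁, Matrix.fromBlocks_apply₂₂, Matrix.of_apply,
        Matrix.cons_val_zero, Matrix.cons_val_one, Matrix.cons_val', Matrix.cons_val_fin_one,
        Matrix.zero_apply, Fin.zero_eta, Fin.mk_one] <;>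
      first | assumption | rfl | exact g21 x hx | exact hblock x hx _ _ | exact g34 x hx
  · have e : θ' x * G x i2 i4 = 4 / 3 * θ x * G x i1 i2 := by
      rw [h6, h1]
      field_simp
    exact (f2 x hx).congr_deriv (by
      linear_combination e - β x * b4 x hx + 3 / 4 * β' x * g21 x hx)
  · have e : θ' x * G x i1 i4 = 2 / 3 * θ x * G x i1 i2 ^ 2 / G x i2 i2 := by
      rw [h7, h1]
      field_simp
    exact (f3 x hx).congr_deriv (by
      linear_combination e - γ x * b2 x hx + 3 / 4 * β' x * h2)

/-! ### Linear differential equations in the complex domain -/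

/-- Local existence of holomorphic solutions of linear differential equations with holomorphic
coefficients: the Picard iteration converges uniformly on a small disc. -/
theorem exists_linear_ode {E : Type*} [NormedAddCommGroup E] [NormedSpace ℂ E] [CompleteSpace E]
    {M : ℂ → E →L[ℂ] E} {c : ℂ} {r : ℝ} (hr : 0 < r)
    (hM : DifferentiableOn ℂ M (Metric.ball c r)) (y₀ : E) :
    ∃ ρ > 0, ρ ≤ r ∧ ∃ y : ℂ → E, y c = y₀ ∧
      ∀ x ∈ Metric.ball c ρ, HasDerivAt y (M x (y x)) x := by
  have hcont : ContinuousAt M c :=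
    (hM.differentiableAt (Metric.isOpen_ball.mem_nhds (Metric.mem_ball_self hr))).continuousAt
  set K : ℝ := ‖M c‖ + 1 with hK
  have hK0 : 0 < K := by positivity
  obtain ⟨r₁, hr₁, hb⟩ : ∃ r₁ > 0, ∀ x ∈ Metric.ball c r₁, ‖M x‖ ≤ K := by
    have : ∀ᶠ x in 𝓝 c, ‖M x‖ < K := hcont.norm.eventually_lt_const (lt_add_one _)
    obtain ⟨r₁, h1, h2⟩ := Metric.eventually_nhds_iff_ball.1 this
    exact ⟨r₁, h1, fun x hx => (h2 x hx).le⟩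
  set ρ : ℝ := min (min r r₁) (1 / (2 * K)) with hρ
  have hρ0 : 0 < ρ := by positivity
  have hρr : ρ ≤ r := (min_le_left _ _).trans (min_le_left _ _)
  have hρ₁ : ρ ≤ r₁ := (min_le_left _ _).trans (min_le_right _ _)
  have hρK : K * ρ ≤ 1 / 2 := by
    have : ρ ≤ 1 / (2 * K) := min_le_right _ _
    calc K * ρ ≤ K * (1 / (2 * K)) := by gcongr
      _ = 1 / 2 := by field_simp
  have hMρ : DifferentiableOn ℂ M (Metric.ball c ρ) := hM.mono (Metric.ball_subset_ball hρr)
  -- one step of the iteration: the primitive of `M Y` which vanishes at `c`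
  have step : ∀ Y : {Y : ℂ → E // DifferentiableOn ℂ Y (Metric.ball c ρ)},
      ∃ Z : {Y : ℂ → E // DifferentiableOn ℂ Y (Metric.ball c ρ)}, Z.1 c = 0 ∧
        ∀ x ∈ Metric.ball c ρ, HasDerivAt Z.1 (M x (Y.1 x)) x := by
    rintro ⟨Y, hY⟩
    obtain ⟨Z, hZ⟩ := (hMρ.clm_apply hY).isExactOn_ball
    refine ⟨⟨fun x => Z x - Z c, fun x hx => ?_⟩, by simp, fun x hx => (hZ x hx).sub_const _⟩
    exact ((hZ x hx).sub_const _).differentiableAt.differentiableWithinAt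
  choose T hT0 hT using step
  let Y : ℕ → {Y : ℂ → E // DifferentiableOn ℂ Y (Metric.ball c ρ)} := fun n =>
    T^[n] ⟨fun _ => y₀, differentiableOn_const _⟩
  have hY0 : (Y 0).1 = fun _ => y₀ := rfl
  have hYs : ∀ n, Y (n + 1) = T (Y n) := fun n => Function.iterate_succ_apply' _ _ _
  have bound : ∀ n, ∀ x ∈ Metric.ball c ρ, ‖(Y n).1 x‖ ≤ ‖y₀‖ * (1 / 2) ^ n := by
    intro n
    induction n with
    | zero => intro x _; simp [hY0]
    | succ n ih =>
      intro x hx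
      have h := (convex_ball c ρ).norm_image_sub_le_of_norm_hasDerivWithin_le
        (f := (Y (n + 1)).1) (f' := fun x => M x ((Y n).1 x)) (C := K * (‖y₀‖ * (1 / 2) ^ n))
        (fun z hz => by rw [hYs]; exact (hT (Y n) z hz).hasDerivWithinAt)
        (fun z hz => (M z).le_of_opNorm_le_of_le (hb z (Metric.ball_subset_ball hρ₁ hz)) (ih z hz))
        (Metric.mem_ball_self hρ0) hx
      rw [hYs, hT0, sub_zero] at h
      rw [hYs]
      refine h.trans ?_
      have hxρ : ‖x - c‖ ≤ ρ := (mem_ball_iff_norm.1 hx).le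
      calc K * (‖y₀‖ * (1 / 2) ^ n) * ‖x - c‖ ≤ K * (‖y₀‖ * (1 / 2) ^ n) * ρ := by gcongr
        _ = (K * ρ) * (‖y₀‖ * (1 / 2) ^ n) := by ring
        _ ≤ (1 / 2) * (‖y₀‖ * (1 / 2) ^ n) := by gcongr
        _ = ‖y₀‖ * (1 / 2) ^ (n + 1) := by ring
  have hsum : Summable fun n : ℕ => ‖y₀‖ * (1 / 2 : ℝ) ^ n :=
    (summable_geometric_of_lt_one (by norm_num) (by norm_num)).mul_left _
  have hYsum : ∀ x ∈ Metric.ball c ρ, Summable fun n => (Y n).1 x := fun x hx =>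
    Summable.of_norm_bounded hsum fun n => bound n x hx
  -- the solution is the sum of the iterated primitives, starting from the constant `y₀`
  refine ⟨ρ, hρ0, hρr, fun x => ∑' n, (Y n).1 x, ?_, fun x hx => ?_⟩
  · change ∑' n, (Y n).1 c = y₀
    rw [tsum_eq_single 0]
    · simp [hY0]
    · rintro (_ | n) hn
      · exact absurd rfl hn
      · rw [hYs, hT0]
  · have hdiff := Complex.differentiableOn_tsum_of_summable_norm hsum (fun n => (Y n).2)
      Metric.isOpen_ball bound
    have hder := Complex.hasSum_deriv_of_summable_norm hsum (fun n => (Y n).2)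
      Metric.isOpen_ball bound hx
    have h0 : deriv (Y 0).1 x = 0 := by rw [hY0]; simp
    have h1 : ∀ n, deriv (Y (n + 1)).1 x = M x ((Y n).1 x) := fun n => by
      rw [hYs]; exact (hT (Y n) x hx).deriv
    have h2 : HasSum (fun n => deriv (Y n).1 x) (M x (∑' n, (Y n).1 x)) := by
      rw [← hasSum_nat_add_iff' 1]
      simpa [h0, h1] using (hYsum x hx).hasSum.mapL (M x)
    rw [← hder.unique h2]
    exact (hdiff.differentiableAt (Metric.isOpen_ball.mem_nhds hx)).hasDerivAt

/-! ### Frames on plane domains -/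

/-- The structure equations of adapted frames on a plane domain: `P⁻¹ P'` is
`adaptedForm α β γ θ` on `V`. The condition `θ ≠ 0` is not included. -/
def FrameODE (V : Set ℂ) (P : ℂ → Sp2C) (α β γ θ : ℂ → ℂ) : Prop :=
  ∀ x ∈ V, HasMatDerivAt (fun y => (P y).1)
    ((P x).1 * adaptedForm (α x) (β x) (γ x) (θ x)) x

/-- The Lagrangian plane `[A₁ ∧ A₂]` spanned by the first two columns of `A`. -/
def framePlane (A : Sp2C) : Submodule ℂ C4 := Submodule.span ℂ {A.1.col i1, A.1.col i2}

theorem mem_framePlane {A : Sp2C} {v : C4} :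
    v ∈ framePlane A ↔ ∀ i, (A.1⁻¹ *ᵥ v) (Sum.inr i) = 0 := by
  have hcol : ∀ w : C4, A.1 *ᵥ w = w i1 • A.1.col i1 + w i2 • A.1.col i2
      + (w i3 • A.1.col i3 + w i4 • A.1.col i4) := fun w => by
    ext i
    simp [Matrix.mulVec, dotProduct, Fintype.sum_sum_type, Matrix.col_apply, mul_comm]
  rw [framePlane, Submodule.mem_span_pair]
  constructor
  · rintro ⟨a, b, rfl⟩ i
    have : a • A.1.col i1 + b • A.1.col i2 = A.1 *ᵥ Sum.elim ![a, b] 0 := by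
      rw [hcol]
      simp
    rw [this, Matrix.mulVec_mulVec, Sp2C.inv_mul, Matrix.one_mulVec]
    rfl
  · intro h
    refine ⟨(A.1⁻¹ *ᵥ v) i1, (A.1⁻¹ *ᵥ v) i2, ?_⟩
    have h2 := hcol (A.1⁻¹ *ᵥ v)
    rw [Matrix.mulVec_mulVec, Sp2C.mul_inv, Matrix.one_mulVec, h 0, h 1] at h2
    simpa using h2.symm

theorem finrank_framePlane (A : Sp2C) : Module.finrank ℂ (framePlane A) = 2 := by
  have hinj : Function.Injective A.1.mulVec :=
    Matrix.mulVec_injective_iff_isUnit.2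
      ((Matrix.isUnit_iff_isUnit_det _).2 (SymplecticGroup.symplectic_det A.2))
  have hli := (Matrix.mulVec_injective_iff.1 hinj).comp Sum.inl Sum.inl_injective
  have hrange : Set.range (A.1.col ∘ Sum.inl) = {A.1.col i1, A.1.col i2} := by
    ext v
    simp [Fin.exists_fin_two, eq_comm]
  rw [framePlane, ← hrange]
  exact (finrank_span_eq_card hli).trans (Fintype.card_fin 2)

/-- Two frames span the same plane exactly when they differ by a block triangular matrix. -/
theorem framePlane_eq_iff {A B : Sp2C} :
    framePlane B = framePlane A ↔ ∀ i j, (A.1⁻¹ * B.1) (Sum.inr i) (Sum.inl j) = 0 := by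
  have hcol : ∀ j, A.1⁻¹ *ᵥ B.1.col j = (A.1⁻¹ * B.1).col j := fun j => rfl
  constructor
  · intro h i j
    have hj : B.1.col (Sum.inl j) ∈ framePlane A := by
      rw [← h]
      refine Submodule.subset_span ?_
      fin_cases j
      · exact Or.inl rfl
      · exact Or.inr rfl
    have := mem_framePlane.1 hj i
    rwa [hcol] at this
  · intro h
    refine Submodule.eq_of_le_of_finrank_eq (Submodule.span_le.2 ?_)
      (by rw [finrank_framePlane, finrank_framePlane])
    rintro _ (rfl | rfl)
    · exact mem_framePlane.2 fun i => by rw [hcol]; exact h i 0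
    · exact mem_framePlane.2 fun i => by rw [hcol]; exact h i 1

theorem map_framePlane (X A : Sp2C) :
    (framePlane A).map (Matrix.mulVecLin X.1) = framePlane (X * A) := by
  rw [framePlane, framePlane, Submodule.map_span, Set.image_pair]
  rfl

/-! ### Flat frames and Möbius transformations -/

/-- `gaugeMat t u` as an element of the symplectic group (the identity for `t = 0`). -/
def gaugeSp (t u : ℂ) : Sp2C :=
  if h : t ≠ 0 then ⟨gaugeMat t u, gaugeMat_mem h u⟩ else 1

theorem coe_gaugeSp {t : ℂ} (ht : t ≠ 0) (u : ℂ) : (gaugeSp t u).1 = gaugeMat t u := by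
  rw [gaugeSp, dif_pos ht]

theorem framePlane_mul_gaugeSp (A : Sp2C) {t : ℂ} (ht : t ≠ 0) (u : ℂ) :
    framePlane (A * gaugeSp t u) = framePlane A := by
  rw [framePlane_eq_iff]
  intro i j
  change (A.1⁻¹ * (A.1 * (gaugeSp t u).1)) _ _ = 0
  rw [← Matrix.mul_assoc, Sp2C.inv_mul, Matrix.one_mul, coe_gaugeSp ht]
  rfl

theorem FrameODE.mono {V W : Set ℂ} {P : ℂ → Sp2C} {α β γ θ : ℂ → ℂ}
    (h : FrameODE V P α β γ θ) (hW : W ⊆ V) : FrameODE W P α β γ θ := fun x hx => h x (hW hx)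

/-- The action of the structure group on adapted frames. -/
theorem FrameODE.gauge {V : Set ℂ} (hV : IsOpen V) {P : ℂ → Sp2C}
    {α β γ θ α' β' t u : ℂ → ℂ} (hP : FrameODE V P α β γ θ)
    (h0 : ∀ x ∈ V, t x ≠ 0)
    (ht : ∀ x ∈ V, HasDerivAt t (α' x * t x + θ x * u x / 3 - α x * t x) x)
    (hu : ∀ x ∈ V, HasDerivAt u (3 / 4 * β' x * t x ^ 3 + α' x * u x
      + 2 / 3 * θ x * u x ^ 2 / t x - 3 * α x * u x - 3 / 4 * β x * t x) x) :
    FrameODE V (fun x => P x * gaugeSp (t x) (u x)) α' β' (fun x => γ x / t x ^ 6)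
      (fun x => t x ^ 2 * θ x) := by
  intro x hx
  have h1 := (hP x hx).mul (hasMatDerivAt_gaugeMat (γ := γ x) (h0 x hx) (ht x hx) (hu x hx))
  have h2 : HasMatDerivAt (fun y => (P y * gaugeSp (t y) (u y)).1) _ x :=
    h1.congr <| by
      filter_upwards [hV.mem_nhds hx] with y hy
      change (P y).1 * (gaugeSp (t y) (u y)).1 = _
      rw [coe_gaugeSp (h0 y hy)]
  convert h2 using 1
  change (P x).1 * (gaugeSp (t x) (u x)).1 * _ = _
  rw [coe_gaugeSp (h0 x hx)]
  simp only [Matrix.mul_sub, Matrix.mul_assoc]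
  abel

/-- Two adapted frames along the same curve differ by the action of the structure group. -/
theorem FrameODE.exists_gauge {V : Set ℂ} (hV : IsOpen V) {P Q : ℂ → Sp2C}
    {α β γ θ α' β' γ' θ' : ℂ → ℂ} (hQ : FrameODE V Q α β γ θ) (hP : FrameODE V P α' β' γ' θ')
    (hPQ : ∀ x ∈ V, framePlane (P x) = framePlane (Q x)) (hθ' : ∀ x ∈ V, θ' x ≠ 0) :
    ∃ t u : ℂ → ℂ, ∀ x ∈ V, t x ≠ 0 ∧ θ' x = t x ^ 2 * θ x ∧ γ x = γ' x * t x ^ 6 ∧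
    HasDerivAt t (α' x * t x + θ x * u x / 3 - α x * t x) x ∧
    HasDerivAt u (3 / 4 * β' x * t x ^ 3 + α' x * u x + 2 / 3 * θ x * u x ^ 2 / t x
      - 3 * α x * u x - 3 / 4 * β x * t x) x := by
  obtain ⟨t, u, h⟩ := gauge_rigidity hV (G := fun x => ((Q x)⁻¹ * P x).1)
    (fun x _ => ((Q x)⁻¹ * P x).2)
    (fun x hx i j => by
      have := framePlane_eq_iff.1 (hPQ x hx) i j
      rwa [← SymplecticGroup.coe_inv'] at this) hθ'
    (α := α) (β := β) (γ := γ) (θ := θ) (α' := α') (β' := β') (γ' := γ')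
    (fun x hx => by
      have := (hQ x hx).inv.mul (hP x hx)
      simp only [← SymplecticGroup.coe_inv'] at this
      convert this using 1
      · rfl
      change ((Q x)⁻¹.1 * (P x).1) * _ - _ * ((Q x)⁻¹.1 * (P x).1) = _
      simp only [Matrix.neg_mul, Matrix.mul_assoc]
      abel)
  exact ⟨t, u, fun x hx => ⟨(h x hx).1, (h x hx).2.2⟩⟩

/-- The quartic differential `γ θ³` does not depend on the adapted frame. -/
theorem FrameODE.quartic_eq {V : Set ℂ} (hV : IsOpen V) {P Q : ℂ → Sp2C}
    {α β γ θ α' β' γ' θ' : ℂ → ℂ} (hQ : FrameODE V Q α β γ θ) (hP : FrameODE V P α' β' γ' θ')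
    (hPQ : ∀ x ∈ V, framePlane (P x) = framePlane (Q x)) (hθ' : ∀ x ∈ V, θ' x ≠ 0)
    {x : ℂ} (hx : x ∈ V) : γ' x * θ' x ^ 3 = γ x * θ x ^ 3 := by
  obtain ⟨t, u, h⟩ := hQ.exists_gauge hV hP hPQ hθ'
  obtain ⟨-, h1, h2, -⟩ := h x hx
  rw [h1, h2]
  ring

/-- A function on a disc whose derivative vanishes is constant. -/
theorem eq_center_of_hasDerivAt_zero {c : ℂ} {R : ℝ} {F : ℂ → ℂ}
    (hF : ∀ x ∈ Metric.ball c R, HasDerivAt F 0 x) {x : ℂ} (hx : x ∈ Metric.ball c R) :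
    F x = F c := by
  have hc : c ∈ Metric.ball c R := Metric.mem_ball_self (dist_nonneg.trans_lt hx)
  exact Metric.isOpen_ball.is_const_of_deriv_eq_zero (convex_ball c R).isPreconnected
    (fun y hy => (hF y hy).differentiableAt.differentiableWithinAt)
    (fun y hy => (hF y hy).deriv) hx hc

/-- If one curve has adapted frames along which the Cartan connection is flat with respect to the
coordinates `x` and `w`, then `w` is a Möbius transformation of `x`. -/
theorem FrameODE.moebius {c : ℂ} {R : ℝ} (hR : 0 < R) {P Q : ℂ → Sp2C} {γ γ' w w' : ℂ → ℂ}
    {k : ℂ} (hk : k ≠ 0)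
    (hQ : FrameODE (Metric.ball c R) Q 0 0 γ fun x => k * w' x)
    (hP : FrameODE (Metric.ball c R) P 0 0 γ' fun _ => k)
    (hPQ : ∀ x ∈ Metric.ball c R, framePlane (P x) = framePlane (Q x))
    (hw : ∀ x ∈ Metric.ball c R, HasDerivAt w (w' x) x) :
    ∃ a b e d : ℂ, a * d - b * e ≠ 0 ∧ ∀ x ∈ Metric.ball c R,
      e * x + d ≠ 0 ∧ w x = (a * x + b) / (e * x + d) := by
  obtain ⟨t, u, h⟩ := hQ.exists_gauge Metric.isOpen_ball hP hPQ fun _ _ => hk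
  have ht := fun x hx => (h x hx).1
  have hw' : ∀ x ∈ Metric.ball c R, w' x = 1 / t x ^ 2 := fun x hx => by
    have h1 := (h x hx).2.1
    have := ht x hx
    field_simp
    exact mul_left_cancel₀ hk (by linear_combination -h1)
  -- `u / t ^ 2` is constant, so `t` is affine in `x`
  have dv : ∀ x ∈ Metric.ball c R, HasDerivAt (fun x => u x / t x ^ 2) 0 x := fun x hx => by
    obtain ⟨h0, -, -, h3, h4⟩ := h x hx
    refine (h4.div (h3.pow 2) (pow_ne_zero 2 h0)).congr_deriv ?_
    simp only [Pi.zero_apply, Pi.pow_apply]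
    field_simp
    ring
  -- the derivative of `t` is `k (u / t ^ 2) / 3`, a constant
  set e : ℂ := k * (u c / t c ^ 2) / 3 with he
  have dt : ∀ x ∈ Metric.ball c R, HasDerivAt t e x := fun x hx => by
    obtain ⟨h0, -, -, h3, h4⟩ := h x hx
    refine h3.congr_deriv ?_
    have := eq_center_of_hasDerivAt_zero dv hx
    rw [he, ← this, hw' x hx]
    simp only [Pi.zero_apply]
    ring
  set d : ℂ := t c - e * c with hd
  have tx : ∀ x ∈ Metric.ball c R, t x = e * x + d := fun x hx => by
    have h1 : ∀ x ∈ Metric.ball c R, HasDerivAt (fun x => t x - e * x) 0 x := fun x hx =>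
      ((dt x hx).sub ((hasDerivAt_id x).const_mul e)).congr_deriv (by simp)
    have := eq_center_of_hasDerivAt_zero h1 hx
    rw [hd, ← this]
    ring
  -- the derivative `1 / t + e w` of `w t` is constant, so `w t` is affine as well
  have da : ∀ x ∈ Metric.ball c R, HasDerivAt (fun x => 1 / t x + e * w x) 0 x := fun x hx => by
    have h0 := ht x hx
    refine (((hasDerivAt_const x (1 : ℂ)).div (dt x hx) h0).add
      ((hw x hx).const_mul e)).congr_deriv ?_
    rw [hw' x hx]
    field_simp
    ring
  set a : ℂ := 1 / t c + e * w c with ha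
  have db : ∀ x ∈ Metric.ball c R, HasDerivAt (fun x => w x * t x - a * x) 0 x := fun x hx => by
    have h0 := ht x hx
    refine (((hw x hx).mul (dt x hx)).sub ((hasDerivAt_id x).const_mul a)).congr_deriv ?_
    have := eq_center_of_hasDerivAt_zero da hx
    rw [ha, ← this, hw' x hx]
    field_simp
    ring
  refine ⟨a, w c * t c - a * c, e, d, ?_, fun x hx => ?_⟩
  · have h0 := ht c (Metric.mem_ball_self hR)
    have : a * d - (w c * t c - a * c) * e = 1 := by
      rw [hd, ha]
      field_simp
      ring
    rw [this]
    exact one_ne_zero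
  · rw [← tx x hx]
    refine ⟨ht x hx, ?_⟩
    have := eq_center_of_hasDerivAt_zero db hx
    rw [eq_div_iff (ht x hx), ← this]
    ring

/-- Adapted frames with the same Maurer-Cartan form differ by a constant symplectic matrix. -/
theorem FrameODE.exists_const {c : ℂ} {R : ℝ} {P Q : ℂ → Sp2C} {α β γ θ : ℂ → ℂ}
    (hP : FrameODE (Metric.ball c R) P α β γ θ) (hQ : FrameODE (Metric.ball c R) Q α β γ θ) :
    ∃ X : Sp2C, ∀ x ∈ Metric.ball c R, P x = X * Q x := by
  refine ⟨P c * (Q c)⁻¹, fun x hx => ?_⟩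
  have hd : ∀ x ∈ Metric.ball c R, HasMatDerivAt (fun y => (P y * (Q y)⁻¹).1) 0 x := fun x hx => by
    have := (hP x hx).mul (hQ x hx).inv
    simp only [← SymplecticGroup.coe_inv'] at this
    convert this using 1
    · rfl
    rw [Matrix.mul_neg, Matrix.mul_assoc, add_neg_cancel]
  have h1 : P x * (Q x)⁻¹ = P c * (Q c)⁻¹ := by
    ext i j
    exact eq_center_of_hasDerivAt_zero (fun y hy => hd y hy i j) hx
  rw [← h1, inv_mul_cancel_right]

/-- Two curves with adapted frames which are flat with respect to coordinates related by a Möbius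
transformation are congruent if their quartic differentials agree: the second frame can be changed
so that the Maurer-Cartan forms agree. -/
theorem FrameODE.congruent {z : ℂ} {R : ℝ} {P Q : ℂ → Sp2C} {γ γ' w w' : ℂ → ℂ}
    {k : ℂ} (hk : k ≠ 0)
    (hQ : FrameODE (Metric.ball z R) Q 0 0 γ fun x => k * w' x)
    (hP : FrameODE (Metric.ball z R) P 0 0 γ' fun _ => k)
    (hw : ∀ x ∈ Metric.ball z R, HasDerivAt w (w' x) x)
    {a b c d : ℂ} (hdet : a * d - b * c ≠ 0)
    (hm : ∀ x ∈ Metric.ball z R, c * x + d ≠ 0 ∧ w x = (a * x + b) / (c * x + d))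
    (hδ : ∀ x ∈ Metric.ball z R, γ' x * k ^ 3 = γ x * (k * w' x) ^ 3) :
    ∃ X : Sp2C, ∀ x ∈ Metric.ball z R, framePlane (P x) = framePlane (X * Q x) := by
  -- the change of frames of the Möbius transformation: `t ^ 2 = 1 / w'`, and `u` is forced by `t'`
  obtain ⟨σ, hσ⟩ : ∃ σ : ℂ, σ ^ 2 = a * d - b * c := IsAlgClosed.exists_pow_nat_eq _ two_pos
  have hσ0 : σ ≠ 0 := by
    rintro rfl
    exact hdet (by rw [← hσ]; ring)
  set t : ℂ → ℂ := fun x => (c * x + d) / σ with ht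
  set u : ℂ → ℂ := fun x => 3 * t x ^ 2 * (c / σ) / k with hu
  have h0 : ∀ x ∈ Metric.ball z R, t x ≠ 0 := fun x hx => div_ne_zero (hm x hx).1 hσ0
  have hw' : ∀ x ∈ Metric.ball z R, w' x = 1 / t x ^ 2 := fun x hx => by
    have hcx := (hm x hx).1
    have h1 : HasDerivAt (fun x => (a * x + b) / (c * x + d))
        ((a * (c * x + d) - (a * x + b) * c) / (c * x + d) ^ 2) x := by
      refine ((((hasDerivAt_id x).const_mul a).add_const b).div
        (((hasDerivAt_id x).const_mul c).add_const d) hcx).congr_deriv ?_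
      simp
    rw [(hw x hx).unique (h1.congr_of_eventuallyEq (Filter.eventually_of_mem
      (Metric.isOpen_ball.mem_nhds hx) fun y hy => (hm y hy).2))]
    simp only [ht]
    field_simp
    rw [hσ]
    ring
  have dt : ∀ x, HasDerivAt t (c / σ) x := fun x =>
    ((((hasDerivAt_id x).const_mul c).add_const d).div_const σ).congr_deriv (by simp)
  have hG := hQ.gauge Metric.isOpen_ball (α' := 0) (β' := 0) (t := t) (u := u) h0
    (fun x hx => (dt x).congr_deriv (by
      have := h0 x hx
      simp only [hw' x hx, hu, Pi.zero_apply]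
      field_simp
      ring))
    (fun x hx => (((((dt x).pow 2).const_mul 3).mul_const (c / σ)).div_const k).congr_deriv (by
      have := h0 x hx
      simp only [hw' x hx, hu, Pi.zero_apply]
      field_simp
      ring))
  have hG' : FrameODE (Metric.ball z R) (fun x => Q x * gaugeSp (t x) (u x))
      0 0 γ' fun _ => k := fun x hx => by
    have h1 := hG x hx
    have h2 : γ x / t x ^ 6 = γ' x := by
      have h3 := hδ x hx
      have := h0 x hx
      rw [hw' x hx] at h3
      field_simp at h3 ⊢
      exact h3.symm
    have h3 : t x ^ 2 * (k * w' x) = k := by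
      have := h0 x hx
      rw [hw' x hx]
      field_simp
    beta_reduce at h1 ⊢
    rwa [h2, h3] at h1
  obtain ⟨X, hX⟩ := hP.exists_const hG'
  refine ⟨X, fun x hx => ?_⟩
  rw [hX x hx, ← mul_assoc, framePlane_mul_gaugeSp _ (h0 x hx)]

/-- Near every point, an adapted frame can be transformed into one along which the Cartan
connection is flat with respect to a coordinate `ζ`. The factor `l` is the normalization of the
projective coordinate. -/
theorem FrameODE.exists_flat {z₀ : ℂ} {R : ℝ} (hR : 0 < R) {P : ℂ → Sp2C} {α β γ θ : ℂ → ℂ}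
    (hP : FrameODE (Metric.ball z₀ R) P α β γ θ)
    (hα : DifferentiableOn ℂ α (Metric.ball z₀ R)) (hβ : DifferentiableOn ℂ β (Metric.ball z₀ R))
    (hθ : DifferentiableOn ℂ θ (Metric.ball z₀ R)) (hθ0 : θ z₀ ≠ 0) {l : ℂ} (hl : l ≠ 0) :
    ∃ ρ > 0, ρ ≤ R ∧ ∃ t u ζ : ℂ → ℂ, (∀ x ∈ Metric.ball z₀ ρ, t x ≠ 0) ∧
      FrameODE (Metric.ball z₀ ρ) (fun x => P x * gaugeSp (t x) (u x)) 0 0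
        (fun x => γ x / t x ^ 6) (fun x => t x ^ 2 * θ x) ∧
      (∀ x ∈ Metric.ball z₀ ρ, HasDerivAt ζ (l * (t x ^ 2 * θ x)) x) ∧
      Set.InjOn ζ (Metric.ball z₀ ρ) := by
  -- In terms of `a = 1 / t` and `b = u / (3 t ^ 2)` the equations for a flat frame are linear:
  -- `(a, b)` is the first row of a solution of `F' = F η`, where `η` is the Cartan connection.
  let M : ℂ → (ℂ × ℂ) →L[ℂ] (ℂ × ℂ) := fun x =>
    α x • (((ContinuousLinearMap.fst ℂ ℂ ℂ).prod (-ContinuousLinearMap.snd ℂ ℂ ℂ)))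
    - θ x • ((ContinuousLinearMap.snd ℂ ℂ ℂ).prod 0)
    - β x • ((0 : (ℂ × ℂ) →L[ℂ] ℂ).prod ((1 / 4 : ℂ) • ContinuousLinearMap.fst ℂ ℂ ℂ))
  have hM : DifferentiableOn ℂ M (Metric.ball z₀ R) :=
    ((hα.smul_const _).sub (hθ.smul_const _)).sub (hβ.smul_const _)
  obtain ⟨ρ, hρ, hρR, y, hy0, hy⟩ := exists_linear_ode hR hM ((1 : ℂ), (0 : ℂ))
  have hz₀ : z₀ ∈ Metric.ball z₀ ρ := Metric.mem_ball_self hρ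
  have da : ∀ x ∈ Metric.ball z₀ ρ, HasDerivAt (fun x => (y x).1)
      (α x * (y x).1 - θ x * (y x).2) x := fun x hx => by
    refine (hasFDerivAt_fst.comp_hasDerivAt x (hy x hx)).congr_deriv ?_
    simp [M]
  have db : ∀ x ∈ Metric.ball z₀ ρ, HasDerivAt (fun x => (y x).2)
      (-α x * (y x).2 - β x * (y x).1 / 4) x := fun x hx => by
    refine (hasFDerivAt_snd.comp_hasDerivAt x (hy x hx)).congr_deriv ?_
    simp [M]
    ring
  obtain ⟨ρ₁, hρ₁, hne⟩ : ∃ ρ₁ > 0, ∀ x ∈ Metric.ball z₀ ρ₁, (y x).1 ≠ 0 := by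
    have h1 : (y z₀).1 ≠ 0 := by rw [hy0]; exact one_ne_zero
    exact Metric.eventually_nhds_iff_ball.1 ((da z₀ hz₀).continuousAt.eventually_ne h1)
  set ρ₂ := min ρ ρ₁ with hρ₂
  have hb : Metric.ball z₀ ρ₂ ⊆ Metric.ball z₀ ρ := Metric.ball_subset_ball (min_le_left _ _)
  have hb₁ : Metric.ball z₀ ρ₂ ⊆ Metric.ball z₀ ρ₁ := Metric.ball_subset_ball (min_le_right _ _)
  have hρ₂0 : 0 < ρ₂ := lt_min hρ hρ₁
  have hbR : Metric.ball z₀ ρ₂ ⊆ Metric.ball z₀ R := hb.trans (Metric.ball_subset_ball hρR)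
  set t : ℂ → ℂ := fun x => 1 / (y x).1 with ht
  set u : ℂ → ℂ := fun x => 3 * (y x).2 / (y x).1 ^ 2 with hu
  have h0 : ∀ x ∈ Metric.ball z₀ ρ₂, t x ≠ 0 := fun x hx => one_div_ne_zero (hne x (hb₁ hx))
  have hflat := (hP.mono hbR).gauge Metric.isOpen_ball (α' := 0) (β' := 0) (t := t) (u := u) h0
    (fun x hx => by
      have h1 := hne x (hb₁ hx)
      refine ((hasDerivAt_const x (1 : ℂ)).div (da x (hb hx)) h1).congr_deriv ?_
      simp only [ht, hu, Pi.zero_apply]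
      field_simp
      ring)
    (fun x hx => by
      have h1 := hne x (hb₁ hx)
      refine (((db x (hb hx)).const_mul 3).div ((da x (hb hx)).pow 2)
        (pow_ne_zero 2 h1)).congr_deriv ?_
      simp only [ht, hu, Pi.zero_apply, Pi.pow_apply]
      field_simp
      ring)
  have hdiff : DifferentiableOn ℂ (fun x => l * (t x ^ 2 * θ x)) (Metric.ball z₀ ρ₂) := by
    intro x hx
    have h1 : DifferentiableAt ℂ t x := by
      have := (da x (hb hx)).differentiableAt
      exact (differentiableAt_const _).div this (hne x (hb₁ hx))
    exact (((h1.differentiableWithinAt).pow 2).mul (hθ.mono hbR x hx)).const_mul l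
  obtain ⟨ζ, hζ⟩ := hdiff.isExactOn_ball
  have hz₂ : z₀ ∈ Metric.ball z₀ ρ₂ := Metric.mem_ball_self hρ₂0
  -- `ζ` is injective near `z₀` because its derivative does not vanish there
  have hinj : ∃ U ∈ 𝓝 z₀, Set.InjOn ζ U := by
    have hA : AnalyticAt ℂ ζ z₀ := DifferentiableOn.analyticAt
      (fun x hx => (hζ x hx).differentiableAt.differentiableWithinAt)
      (Metric.isOpen_ball.mem_nhds hz₂)
    have hs : HasStrictDerivAt ζ (l * (t z₀ ^ 2 * θ z₀)) z₀ := by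
      have := hA.hasStrictDerivAt
      rwa [(hζ z₀ hz₂).deriv] at this
    have hn : l * (t z₀ ^ 2 * θ z₀) ≠ 0 :=
      mul_ne_zero hl (mul_ne_zero (pow_ne_zero 2 (h0 z₀ hz₂)) hθ0)
    obtain ⟨e, he, hcoe⟩ : ∃ e : OpenPartialHomeomorph ℂ ℂ, z₀ ∈ e.source ∧ ⇑e = ζ :=
      ⟨(hs.hasStrictFDerivAt_equiv hn).toOpenPartialHomeomorph ζ,
        (hs.hasStrictFDerivAt_equiv hn).mem_toOpenPartialHomeomorph_source,
        (hs.hasStrictFDerivAt_equiv hn).toOpenPartialHomeomorph_coe⟩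
    exact ⟨e.source, e.open_source.mem_nhds he, hcoe ▸ e.injOn⟩
  obtain ⟨U, hU, hinjU⟩ := hinj
  obtain ⟨ρ₃, hρ₃, hU₃⟩ := Metric.mem_nhds_iff.1 hU
  have hs : Metric.ball z₀ (min ρ₂ ρ₃) ⊆ Metric.ball z₀ ρ₂ :=
    Metric.ball_subset_ball (min_le_left _ _)
  exact ⟨min ρ₂ ρ₃, lt_min hρ₂0 hρ₃, (min_le_left _ _).trans ((min_le_left _ _).trans hρR), t, u, ζ,
    fun x hx => h0 x (hs hx), hflat.mono hs, fun x hx => hζ x (hs hx),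
    hinjU.mono ((Metric.ball_subset_ball (min_le_right _ _)).trans hU₃)⟩

/-! ### The Maurer-Cartan form on Riemann surfaces -/

variable {S : Type*} [TopologicalSpace S] [ChartedSpace ℂ S]
  {S' : Type*} [TopologicalSpace S'] [ChartedSpace ℂ S']

/-- The matrix-valued differential of a map into the symplectic group. -/
theorem mul_mcForm (A : S → Sp2C) (p : S) (v : TangentSpace 𝓘(ℂ) p) (i j : Idx) :
    ((A p).1 * mcForm A p v) i j = mfderiv 𝓘(ℂ) 𝓘(ℂ) (fun q => (A q).1 i j) p v := by
  rw [mcForm, ← Matrix.mul_assoc, Sp2C.mul_inv, Matrix.one_mul]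
  rfl

theorem mcForm_smul (A : S → Sp2C) (p : S) (c : ℂ) (v : TangentSpace 𝓘(ℂ) p) :
    mcForm A p (c • v) = c • mcForm A p v := by
  rw [mcForm, mcForm, ← Matrix.mul_smul]
  congr 1
  ext i j
  exact map_smul (mfderiv 𝓘(ℂ) 𝓘(ℂ) (fun q => (A q).1 i j) p) c v

theorem hasMFDerivAt_entries_comp {A : S → Sp2C} {h : S' → S} {p : S'} (X : Sp2C)
    (hA : ∀ i j, MDifferentiableAt 𝓘(ℂ) 𝓘(ℂ) (fun q => (A q).1 i j) (h p))
    (hh : MDifferentiableAt 𝓘(ℂ) 𝓘(ℂ) h p) (i j : Idx) :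
    HasMFDerivAt 𝓘(ℂ) 𝓘(ℂ) (fun q => (X * A (h q)).1 i j) p
      (∑ k, X.1 i k • (mfderiv 𝓘(ℂ) 𝓘(ℂ) (fun q => (A q).1 k j) (h p)).comp
        (mfderiv 𝓘(ℂ) 𝓘(ℂ) h p)) := by
  have h1 := HasMFDerivAt.sum (t := Finset.univ) fun k _ =>
    ((hA k j).hasMFDerivAt.comp p hh.hasMFDerivAt).const_smul (X.1 i k)
  refine HasMFDerivAt.congr_of_eventuallyEq h1 (Filter.Eventually.of_forall fun q => ?_)
  change (X.1 * (A (h q)).1) i j = _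
  simp [Matrix.mul_apply]

/-- The Maurer-Cartan form is natural, and invariant under left translations. -/
theorem mcForm_comp {A : S → Sp2C} {h : S' → S} {p : S'} (X : Sp2C)
    (hA : ∀ i j, MDifferentiableAt 𝓘(ℂ) 𝓘(ℂ) (fun q => (A q).1 i j) (h p))
    (hh : MDifferentiableAt 𝓘(ℂ) 𝓘(ℂ) h p) (v : TangentSpace 𝓘(ℂ) p) :
    mcForm (fun q => X * A (h q)) p v = mcForm A (h p) (mfderiv 𝓘(ℂ) 𝓘(ℂ) h p v) := by
  have h1 : (X * A (h p)).1 * mcForm (fun q => X * A (h q)) p v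
      = (X * A (h p)).1 * mcForm A (h p) (mfderiv 𝓘(ℂ) 𝓘(ℂ) h p v) := by
    ext i j
    rw [mul_mcForm (fun q => X * A (h q)), (hasMFDerivAt_entries_comp X hA hh i j).mfderiv]
    have hX : (X * A (h p)).1 = X.1 * (A (h p)).1 := rfl
    rw [hX, Matrix.mul_assoc]
    refine (sum_apply _ _ _).trans ((Finset.sum_congr rfl fun k _ => ?_).trans
      (Matrix.mul_apply (M := X.1)).symm)
    rw [mul_mcForm]
    rfl
  have h2 := congrArg ((X * A (h p)).1⁻¹ * ·) h1
  simpa only [← Matrix.mul_assoc, Sp2C.inv_mul, Matrix.one_mul] using h2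

theorem mcForm_congr {A B : S → Sp2C} {p : S} (h : A =ᶠ[𝓝 p] B) (v : TangentSpace 𝓘(ℂ) p) :
    mcForm A p v = mcForm B p v := by
  have h1 : (A p).1 * mcForm A p v = (A p).1 * mcForm B p v := by
    ext i j
    have h0 : (fun q => (A q).1 i j) =ᶠ[𝓝 p] fun q => (B q).1 i j :=
      h.fun_comp fun M : Sp2C => M.1 i j
    rw [mul_mcForm, h0.mfderiv_eq, h.eq_of_nhds, mul_mcForm]
  have h2 := congrArg ((A p).1⁻¹ * ·) h1
  simpa only [← Matrix.mul_assoc, Sp2C.inv_mul, Matrix.one_mul] using h2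

/-- A complex number as a tangent vector of `ℂ`. -/
def tvec (x c : ℂ) : TangentSpace 𝓘(ℂ) x := c

theorem eq_smul_tvec {x : ℂ} (v : TangentSpace 𝓘(ℂ) x) : ∃ c : ℂ, v = c • tvec x 1 :=
  ⟨v, (mul_one (M := ℂ) v).symm⟩

theorem mcForm_eq_of_hasMatDerivAt {P : ℂ → Sp2C} {Φ : Matrix Idx Idx ℂ} {x : ℂ}
    (h : HasMatDerivAt (fun y => (P y).1) ((P x).1 * Φ) x) :
    mcForm P x (tvec x 1) = Φ := by
  have h1 : (P x).1 * mcForm P x (tvec x 1) = (P x).1 * Φ := by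
    ext i j
    rw [mul_mcForm, mfderiv_eq_fderiv]
    exact (h i j).deriv
  have h2 := congrArg ((P x).1⁻¹ * ·) h1
  simpa only [← Matrix.mul_assoc, Sp2C.inv_mul, Matrix.one_mul] using h2

theorem hasMatDerivAt_mcForm {P : ℂ → Sp2C} {x : ℂ}
    (h : ∀ i j, MDifferentiableAt 𝓘(ℂ) 𝓘(ℂ) (fun y => (P y).1 i j) x) :
    HasMatDerivAt (fun y => (P y).1) ((P x).1 * mcForm P x (tvec x 1)) x := by
  intro i j
  refine (h i j).differentiableAt.hasDerivAt.congr_deriv ?_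
  rw [mul_mcForm, mfderiv_eq_fderiv]
  rfl

/-- The Maurer-Cartan form takes values in the symplectic Lie algebra. -/
theorem symplectic_lie {P : ℂ → Sp2C} {Φ : Matrix Idx Idx ℂ} {x : ℂ}
    (h : HasMatDerivAt (fun y => (P y).1) ((P x).1 * Φ) x) :
    Φᵀ * Matrix.J (Fin 2) ℂ + Matrix.J (Fin 2) ℂ * Φ = 0 := by
  have h1 := (h.transpose.mul (hasMatDerivAt_const (Matrix.J (Fin 2) ℂ) x)).mul h
  have h2 : ∀ y, (P y).1ᵀ * Matrix.J (Fin 2) ℂ * (P y).1 = Matrix.J (Fin 2) ℂ :=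
    fun y => SymplecticGroup.mem_iff'.1 (P y).2
  simp only [h2] at h1
  have h3 := h1.unique (hasMatDerivAt_const _ x)
  rw [← h3, Matrix.mul_zero, add_zero, ← Matrix.mul_assoc, h2, Matrix.transpose_mul,
    Matrix.mul_assoc Φᵀ, Matrix.mul_assoc Φᵀ, h2]

/-- The Pfaffian equations of adapted frames, for an element of the symplectic Lie algebra. -/
theorem eq_adaptedForm {Φ : Matrix Idx Idx ℂ}
    (h : Φᵀ * Matrix.J (Fin 2) ℂ + Matrix.J (Fin 2) ℂ * Φ = 0)
    (h31 : Φ i3 i1 = 0) (h41 : Φ i4 i1 = 0) (h21 : Φ i2 i1 - Φ i4 i2 = 0)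
    (h11 : Φ i1 i1 - 3 * Φ i2 i2 = 0) (h12 : 4 * Φ i1 i2 - 3 * Φ i2 i4 = 0)
    (h14 : Φ i1 i4 = 0) :
    Φ = adaptedForm (Φ i2 i2) (Φ i2 i4) (Φ i1 i3) (Φ i4 i2) := by
  have e : ∀ i j, (Φᵀ * Matrix.J (Fin 2) ℂ + Matrix.J (Fin 2) ℂ * Φ) i j = 0 := fun i j => by
    rw [h]; rfl
  have e12 := e i1 i2
  have e13 := e i1 i3
  have e14 := e i1 i4
  have e23 := e i2 i3
  have e24 := e i2 i4
  have e34 := e i3 i4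
  simp [Matrix.mul_apply, Matrix.J, Fintype.sum_sum_type] at e12 e13 e14 e23 e24 e34
  ext i j
  rcases i with i | i <;> rcases j with j | j <;> fin_cases i <;> fin_cases j <;>
    simp [adaptedForm] <;>
    first
    | assumption
    | linear_combination h11
    | linear_combination h12 / 4
    | linear_combination h21
    | linear_combination h14 - e34
    | linear_combination h14 + e34
    | linear_combination h41 + e12
    | linear_combination h41 - e12
    | linear_combination e13 - h11
    | linear_combination e14 - h21
    | linear_combination e23 - h12 / 4
    | linear_combination e24
    | linear_combination -e13 - h11
    | linear_combination -e14 - h21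
    | linear_combination -e23 - h12 / 4
    | linear_combination -e24

theorem mdifferentiableAt_entries {f : S → Q3} {U : Set S} {A : S → Sp2C}
    (hA : IsSymplecticFrame f U A) {p : S} (hp : p ∈ U) (i j : Idx) :
    MDifferentiableAt 𝓘(ℂ) 𝓘(ℂ) (fun q => (A q).1 i j) p :=
  (hA.holomorphic i j p hp).mdifferentiableAt (hA.isOpen.mem_nhds hp)

theorem mdifferentiableAt_entries_comp {A : S → Sp2C} {h : S' → S} {p : S'} (X : Sp2C)
    (hA : ∀ i j, MDifferentiableAt 𝓘(ℂ) 𝓘(ℂ) (fun q => (A q).1 i j) (h p))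
    (hh : MDifferentiableAt 𝓘(ℂ) 𝓘(ℂ) h p) (i j : Idx) :
    MDifferentiableAt 𝓘(ℂ) 𝓘(ℂ) (fun q => (X * A (h q)).1 i j) p :=
  (hasMFDerivAt_entries_comp X hA hh i j).mdifferentiableAt

/-- Left translates of pull-backs of symplectic frames are symplectic frames. -/
theorem IsSymplecticFrame.comp {f : S → Q3} {f' : S' → Q3} {U : Set S} {U' : Set S'}
    {A : S → Sp2C} {h : S' → S} (X : Sp2C) (hA : IsSymplecticFrame f U A) (hU' : IsOpen U')
    (hh : ∀ p ∈ U', MDifferentiableAt 𝓘(ℂ) 𝓘(ℂ) h p) (hU : ∀ p ∈ U', h p ∈ U)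
    (hf : ∀ p ∈ U', f' p = X • f (h p)) :
    IsSymplecticFrame f' U' (fun q => X * A (h q)) where
  isOpen := hU'
  holomorphic i j p hp := (mdifferentiableAt_entries_comp X
    (mdifferentiableAt_entries hA (hU p hp)) (hh p hp) i j).mdifferentiableWithinAt
  lift p hp := by
    rw [hf p hp]
    change (f (h p)).plane.map _ = _
    rw [hA.lift _ (hU p hp)]
    exact map_framePlane X (A (h p))

/-- Left translates of pull-backs of adapted frames under immersions are adapted frames. -/
theorem IsAdaptedFrame.comp {f : S → Q3} {f' : S' → Q3} {U : Set S} {U' : Set S'}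
    {A : S → Sp2C} {h : S' → S} (X : Sp2C) (hA : IsAdaptedFrame f U A) (hU' : IsOpen U')
    (hh : ∀ p ∈ U', MDifferentiableAt 𝓘(ℂ) 𝓘(ℂ) h p) (hU : ∀ p ∈ U', h p ∈ U)
    (hf : ∀ p ∈ U', f' p = X • f (h p))
    (him : ∀ p ∈ U', Function.Injective (mfderiv 𝓘(ℂ) 𝓘(ℂ) h p)) :
    IsAdaptedFrame f' U' (fun q => X * A (h q)) := by
  have hmc : ∀ p ∈ U', ∀ v, mcForm (fun q => X * A (h q)) p v
      = mcForm A (h p) (mfderiv 𝓘(ℂ) 𝓘(ℂ) h p v) := fun p hp v =>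
    mcForm_comp X (mdifferentiableAt_entries hA.toIsSymplecticFrame (hU p hp)) (hh p hp) v
  refine ⟨hA.toIsSymplecticFrame.comp X hU' hh hU hf, fun p hp v => ?_, fun p hp v => ?_,
    fun p hp v => ?_, fun p hp v => ?_, fun p hp v => ?_, fun p hp v => ?_, fun p hp v hv => ?_⟩ <;>
    rw [hmc p hp]
  · exact hA.pfaff31 _ (hU p hp) _
  · exact hA.pfaff41 _ (hU p hp) _
  · rw [hA.pfaff21 _ (hU p hp)]
  · rw [hA.pfaff11 _ (hU p hp)]
  · rw [hA.pfaff12 _ (hU p hp)]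
  · exact hA.pfaff14 _ (hU p hp) _
  · exact hA.pfaff42 _ (hU p hp) _ ((map_ne_zero_iff _ (him p hp)).2 hv)

/-- The Maurer-Cartan form in a local coordinate `e`: it is a multiple of the logarithmic
derivative of `A ∘ e⁻¹`. The factor `1` makes the latter a left translate, as in `mcForm_comp`. -/
theorem mcForm_chart {A : S → Sp2C} {e : OpenPartialHomeomorph S ℂ}
    (he : e.MDifferentiable 𝓘(ℂ) 𝓘(ℂ)) {p : S} (hp : p ∈ e.source)
    (hA : ∀ i j, MDifferentiableAt 𝓘(ℂ) 𝓘(ℂ) (fun q => (A q).1 i j) p)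
    (v : TangentSpace 𝓘(ℂ) p) :
    ∃ c : ℂ, mcForm A p v = c • mcForm (fun x => 1 * A (e.symm x)) (e p) (tvec (e p) 1) := by
  have hA' : ∀ i j, MDifferentiableAt 𝓘(ℂ) 𝓘(ℂ) (fun q => (A q).1 i j) (e.symm (e p)) := by
    rwa [e.left_inv hp]
  have h1 : A =ᶠ[𝓝 p] fun q => 1 * (fun x => 1 * A (e.symm x)) (e q) := by
    filter_upwards [e.open_source.mem_nhds hp] with q hq
    simp [e.left_inv hq]
  obtain ⟨c, hc⟩ := eq_smul_tvec (mfderiv 𝓘(ℂ) 𝓘(ℂ) e p v)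
  refine ⟨c, ?_⟩
  rw [mcForm_congr h1, mcForm_comp (A := fun x => 1 * A (e.symm x)) 1
    (mdifferentiableAt_entries_comp 1 hA' (he.mdifferentiableAt_symm (e.map_source hp)))
    (he.mdifferentiableAt hp), hc, mcForm_smul]

theorem IsAdaptedFrame.mcForm_eq [IsManifold 𝓘(ℂ) 1 S] {f : S → Q3} {U : Set S}
    {A : S → Sp2C} (hA : IsAdaptedFrame f U A) {p : S} (hp : p ∈ U) (v : TangentSpace 𝓘(ℂ) p) :
    mcForm A p v = adaptedForm (mcForm A p v i2 i2) (mcForm A p v i2 i4) (mcForm A p v i1 i3)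
      (mcForm A p v i4 i2) := by
  refine eq_adaptedForm ?_ (hA.pfaff31 p hp v) (hA.pfaff41 p hp v) (hA.pfaff21 p hp v)
    (hA.pfaff11 p hp v) (hA.pfaff12 p hp v) (hA.pfaff14 p hp v)
  have he := mdifferentiable_chart (I := 𝓘(ℂ)) p
  have hps := mem_chart_source ℂ p
  have hd := mdifferentiableAt_entries hA.toIsSymplecticFrame hp
  obtain ⟨c, hc⟩ := mcForm_chart he hps hd v
  have h1 := symplectic_lie (hasMatDerivAt_mcForm (mdifferentiableAt_entries_comp
    (h := (chartAt ℂ p).symm) (p := chartAt ℂ p p) 1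
    (by rwa [(chartAt ℂ p).left_inv hps])
    (he.mdifferentiableAt_symm ((chartAt ℂ p).map_source hps))))
  rw [hc, Matrix.transpose_smul, Matrix.smul_mul, Matrix.mul_smul, ← smul_add, h1, smul_zero]

/-- The pull-back of an adapted frame by a holomorphic map from the plane, followed by a left
translation, satisfies the structure equations. -/
theorem IsAdaptedFrame.frameODE [IsManifold 𝓘(ℂ) 1 S] {f : S → Q3} {U : Set S} {A : S → Sp2C}
    (hA : IsAdaptedFrame f U A) (X : Sp2C) {V : Set ℂ} {φ : ℂ → S}
    (hφ : ∀ x ∈ V, MDifferentiableAt 𝓘(ℂ) 𝓘(ℂ) φ x) (hU : ∀ x ∈ V, φ x ∈ U)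
    {α β γ θ : ℂ → ℂ}
    (hα : ∀ x ∈ V, α x = mcForm A (φ x) (mfderiv 𝓘(ℂ) 𝓘(ℂ) φ x (tvec x 1)) i2 i2)
    (hβ : ∀ x ∈ V, β x = mcForm A (φ x) (mfderiv 𝓘(ℂ) 𝓘(ℂ) φ x (tvec x 1)) i2 i4)
    (hγ : ∀ x ∈ V, γ x = mcForm A (φ x) (mfderiv 𝓘(ℂ) 𝓘(ℂ) φ x (tvec x 1)) i1 i3)
    (hθ : ∀ x ∈ V, θ x = mcForm A (φ x) (mfderiv 𝓘(ℂ) 𝓘(ℂ) φ x (tvec x 1)) i4 i2) :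
    FrameODE V (fun x => X * A (φ x)) α β γ θ := by
  intro x hx
  have hd := mdifferentiableAt_entries hA.toIsSymplecticFrame (hU x hx)
  have h1 := hasMatDerivAt_mcForm (mdifferentiableAt_entries_comp X hd (hφ x hx))
  rwa [mcForm_comp X hd (hφ x hx), hA.mcForm_eq (hU x hx), ← hα x hx, ← hβ x hx, ← hγ x hx,
    ← hθ x hx] at h1

/-- Solutions of the structure equations are adapted frames. -/
theorem FrameODE.isAdaptedFrame {f : ℂ → Q3} {V : Set ℂ} (hV : IsOpen V) {P : ℂ → Sp2C}
    {α β γ θ : ℂ → ℂ} (hP : FrameODE V P α β γ θ)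
    (hf : ∀ x ∈ V, (f x).plane = framePlane (P x)) (hθ : ∀ x ∈ V, θ x ≠ 0) :
    IsAdaptedFrame f V P := by
  have hmc : ∀ x ∈ V, ∀ v : TangentSpace 𝓘(ℂ) x, ∃ c : ℂ, v = c • tvec x 1 ∧
      mcForm P x v = c • adaptedForm (α x) (β x) (γ x) (θ x) := fun x hx v => by
    obtain ⟨c, rfl⟩ := eq_smul_tvec v
    exact ⟨c, rfl, by rw [mcForm_smul, mcForm_eq_of_hasMatDerivAt (hP x hx)]⟩
  refine ⟨⟨hV, fun i j x hx => (hP x hx i j).differentiableAt.mdifferentiableAt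
    |>.mdifferentiableWithinAt, hf⟩, fun x hx v => ?_, fun x hx v => ?_, fun x hx v => ?_,
    fun x hx v => ?_, fun x hx v => ?_, fun x hx v => ?_, fun x hx v hv => ?_⟩ <;>
    obtain ⟨c, hc, h⟩ := hmc x hx v <;> rw [h] <;> simp [adaptedForm]
  · ring
  · ring
  · refine ⟨?_, hθ x hx⟩
    rintro rfl
    exact hv (by rw [hc, zero_smul])

/-! ### Local inverses of holomorphic maps -/

/-- A nonzero linear map between lines is injective. -/
theorem injective_of_apply_ne_zero {p : S'} {q : S}
    {L : TangentSpace 𝓘(ℂ) p →L[ℂ] TangentSpace 𝓘(ℂ) q} {v : TangentSpace 𝓘(ℂ) p}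
    (hv : L v ≠ 0) : Function.Injective L := by
  refine (injective_iff_map_eq_zero L).2 fun w hw => ?_
  by_contra hw0
  obtain ⟨c, rfl⟩ : ∃ c : ℂ, v = c • w :=
    ⟨HDiv.hDiv (α := ℂ) (β := ℂ) v w, (div_mul_cancel₀ (G₀ := ℂ) v hw0).symm⟩
  rw [map_smul, hw, smul_zero] at hv
  exact hv rfl

/-- The inverse function theorem for holomorphic functions of one variable. -/
theorem exists_local_inverse_plane {F : ℂ → ℂ} {x : ℂ}
    (hF : ∀ᶠ y in 𝓝 x, DifferentiableAt ℂ F y) (hx : deriv F x ≠ 0) :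
    ∃ G : ℂ → ℂ, G (F x) = x ∧ (∀ᶠ w in 𝓝 (F x), DifferentiableAt ℂ G w) ∧
      (∀ᶠ w in 𝓝 (F x), F (G w) = w) ∧ ∀ᶠ y in 𝓝 x, G (F y) = y := by
  have hA : AnalyticAt ℂ F x := Complex.analyticAt_iff_eventually_differentiableAt.2 hF
  have hC : ContDiffAt ℂ 1 F x := hA.contDiffAt
  have hs := hA.hasStrictDerivAt.hasStrictFDerivAt_equiv hx
  have hG := hC.to_localInverse hs.hasFDerivAt one_ne_zero
  refine ⟨hC.localInverse hs.hasFDerivAt one_ne_zero, hC.localInverse_apply_image _ _, ?_,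
    hs.eventually_right_inverse, hs.eventually_left_inverse⟩
  filter_upwards [hG.eventually (by simp)] with w hw
  exact hw.differentiableAt one_ne_zero

/-- The inverse function theorem for holomorphic maps between Riemann surfaces. -/
theorem exists_local_inverse [IsManifold 𝓘(ℂ) 1 S] [IsManifold 𝓘(ℂ) 1 S'] {h : S' → S} {p : S'}
    {U' : Set S'} (hU' : U' ∈ 𝓝 p)
    (hh : ∀ q ∈ U', MDifferentiableAt 𝓘(ℂ) 𝓘(ℂ) h q)
    (hinj : Function.Injective (mfderiv 𝓘(ℂ) 𝓘(ℂ) h p)) :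
    ∃ (V : Set S) (σ : S → S'), IsOpen V ∧ h p ∈ V ∧ σ (h p) = p ∧
      (∀ y ∈ V, MDifferentiableAt 𝓘(ℂ) 𝓘(ℂ) σ y ∧ σ y ∈ U' ∧ h (σ y) = y) ∧
      ∀ᶠ q in 𝓝 p, σ (h q) = q := by
  set e := chartAt ℂ p with he
  set e' := chartAt ℂ (h p) with he'
  have hp : p ∈ e.source := mem_chart_source ℂ p
  have hhp : h p ∈ e'.source := mem_chart_source ℂ (h p)
  have de : e.MDifferentiable 𝓘(ℂ) 𝓘(ℂ) := mdifferentiable_chart p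
  have de' : e'.MDifferentiable 𝓘(ℂ) 𝓘(ℂ) := mdifferentiable_chart (h p)
  have hpU : p ∈ U' := mem_of_mem_nhds hU'
  have hcont : ContinuousAt h p := (hh p hpU).continuousAt
  set F : ℂ → ℂ := fun x => e' (h (e.symm x)) with hF
  have hlp : e.symm (e p) = p := e.left_inv hp
  have hFx : F (e p) = e' (h p) := by rw [hF]; simp only [hlp]
  have hsymm : Filter.Tendsto e.symm (𝓝 (e p)) (𝓝 p) := by
    have := e.symm.continuousAt (e.map_source hp)
    rwa [ContinuousAt, hlp] at this
  have hFd : ∀ᶠ x in 𝓝 (e p), MDifferentiableAt 𝓘(ℂ) 𝓘(ℂ) F x := by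
    filter_upwards [e.open_target.mem_nhds (e.map_source hp), hsymm hU',
      hsymm (hcont (e'.open_source.mem_nhds hhp))] with x hx1 hx2 hx3
    exact (de'.mdifferentiableAt hx3).comp x ((hh _ hx2).comp x (de.mdifferentiableAt_symm hx1))
  -- the derivative of `h` in the coordinates is a composition of injective maps
  have hne : deriv F (e p) ≠ 0 := by
    have d1 : MDifferentiableAt 𝓘(ℂ) 𝓘(ℂ) e.symm (e p) :=
      de.mdifferentiableAt_symm (e.map_source hp)
    have d2 : MDifferentiableAt 𝓘(ℂ) 𝓘(ℂ) h (e.symm (e p)) := by rw [hlp]; exact hh p hpU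
    have d3 : MDifferentiableAt 𝓘(ℂ) 𝓘(ℂ) e' (h (e.symm (e p))) := by
      rw [hlp]; exact de'.mdifferentiableAt hhp
    have i1 : Function.Injective (mfderiv 𝓘(ℂ) 𝓘(ℂ) e.symm (e p)) :=
      de.symm.mfderiv_injective (e.map_source hp)
    have i2 : Function.Injective (mfderiv 𝓘(ℂ) 𝓘(ℂ) h (e.symm (e p))) := by rwa [hlp]
    have i3 : Function.Injective (mfderiv 𝓘(ℂ) 𝓘(ℂ) e' (h (e.symm (e p)))) := by
      rw [hlp]; exact de'.mfderiv_injective hhp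
    have hmf : mfderiv 𝓘(ℂ) 𝓘(ℂ) F (e p) = (mfderiv 𝓘(ℂ) 𝓘(ℂ) e' (h (e.symm (e p)))).comp
        ((mfderiv 𝓘(ℂ) 𝓘(ℂ) h (e.symm (e p))).comp (mfderiv 𝓘(ℂ) 𝓘(ℂ) e.symm (e p))) := by
      rw [← mfderiv_comp (e p) d2 d1]
      exact mfderiv_comp (e p) d3 (d2.comp (e p) d1)
    have hi : Function.Injective (mfderiv 𝓘(ℂ) 𝓘(ℂ) F (e p)) := by
      rw [hmf]
      exact i3.comp (i2.comp i1)
    intro h0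
    have h1 : mfderiv 𝓘(ℂ) 𝓘(ℂ) F (e p) (tvec (e p) 1) = 0 := by
      rw [mfderiv_eq_fderiv]
      exact h0
    have h2 : tvec (e p) 1 = 0 := hi (h1.trans (map_zero _).symm)
    exact one_ne_zero (α := ℂ) h2
  obtain ⟨G, G1, G2, G3, G4⟩ := exists_local_inverse_plane
    (hFd.mono fun x hx => hx.differentiableAt) hne
  rw [hFx] at G1 G2 G3
  have te' : Filter.Tendsto e' (𝓝 (h p)) (𝓝 (e' (h p))) := e'.continuousAt hhp
  have tG : Filter.Tendsto G (𝓝 (e' (h p))) (𝓝 (e p)) := by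
    have := G2.self_of_nhds.continuousAt
    rwa [ContinuousAt, G1] at this
  have tσ : Filter.Tendsto (fun y => e.symm (G (e' y))) (𝓝 (h p)) (𝓝 p) :=
    hsymm.comp (tG.comp te')
  have hall : ∀ᶠ y in 𝓝 (h p), MDifferentiableAt 𝓘(ℂ) 𝓘(ℂ) (fun y => e.symm (G (e' y))) y ∧
      e.symm (G (e' y)) ∈ U' ∧ h (e.symm (G (e' y))) = y := by
    filter_upwards [e'.open_source.mem_nhds hhp, te' G2, te' G3,
      (tG.comp te') (e.open_target.mem_nhds (e.map_source hp)), tσ hU',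
      (hcont.tendsto.comp tσ) (e'.open_source.mem_nhds hhp)] with y y1 y2 y3 y4 y5 y6
    refine ⟨?_, y5, e'.injOn y6 y1 y3⟩
    exact (de.mdifferentiableAt_symm y4).comp y
      (DifferentiableAt.mdifferentiableAt y2 |>.comp y (de'.mdifferentiableAt y1))
  obtain ⟨V, hV, hVo, hpV⟩ := eventually_nhds_iff.1 hall
  refine ⟨V, fun y => e.symm (G (e' y)), hVo, hpV, by simp only [G1, hlp], hV, ?_⟩
  filter_upwards [(e.continuousAt hp) G4, e.open_source.mem_nhds hp] with q hq1 hq2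
  have : G (e' (h (e.symm (e q)))) = e q := hq1
  rw [e.left_inv hq2] at this
  rw [this, e.left_inv hq2]

theorem injective_mfderiv_of_leftInverse {h : S' → S} {σ : S → S'} {p : S'}
    (hh : MDifferentiableAt 𝓘(ℂ) 𝓘(ℂ) h p) (hσ : MDifferentiableAt 𝓘(ℂ) 𝓘(ℂ) σ (h p))
    (hl : ∀ᶠ q in 𝓝 p, σ (h q) = q) : Function.Injective (mfderiv 𝓘(ℂ) 𝓘(ℂ) h p) := by
  have h1 : HasMFDerivAt 𝓘(ℂ) 𝓘(ℂ) (fun q : S' => q) p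
      ((mfderiv 𝓘(ℂ) 𝓘(ℂ) σ (h p)).comp (mfderiv 𝓘(ℂ) 𝓘(ℂ) h p)) :=
    (hσ.hasMFDerivAt.comp p hh.hasMFDerivAt).congr_of_eventuallyEq
      (hl.mono fun q hq => hq.symm)
  have h2 := hasMFDerivAt_unique h1 (hasMFDerivAt_id p)
  intro v w hvw
  have h3 := congrArg (fun L => L v) h2
  have h4 := congrArg (fun L => L w) h2
  have h5 : (mfderiv 𝓘(ℂ) 𝓘(ℂ) σ (h p)) (mfderiv 𝓘(ℂ) 𝓘(ℂ) h p v) = v := h3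
  have h6 : (mfderiv 𝓘(ℂ) 𝓘(ℂ) σ (h p)) (mfderiv 𝓘(ℂ) 𝓘(ℂ) h p w) = w := h4
  rw [← h5, ← h6, hvw]

/-- Being an immersion is an open condition. -/
theorem eventually_injective_mfderiv [IsManifold 𝓘(ℂ) 1 S] [IsManifold 𝓘(ℂ) 1 S']
    {h : S' → S} {p : S'} {U' : Set S'} (hU' : U' ∈ 𝓝 p)
    (hh : ∀ q ∈ U', MDifferentiableAt 𝓘(ℂ) 𝓘(ℂ) h q)
    (hinj : Function.Injective (mfderiv 𝓘(ℂ) 𝓘(ℂ) h p)) :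
    ∀ᶠ q in 𝓝 p, Function.Injective (mfderiv 𝓘(ℂ) 𝓘(ℂ) h q) := by
  obtain ⟨V, σ, hV, hpV, -, h1, h2⟩ := exists_local_inverse hU' hh hinj
  filter_upwards [hU', h2.eventually_nhds,
    (hh p (mem_of_mem_nhds hU')).continuousAt (hV.mem_nhds hpV)] with q hq1 hq2 hq3
  exact injective_mfderiv_of_leftInverse (hh q hq1) (h1 _ hq3).1 hq2

/-! ### The quartic differential and projective charts -/

/-- The coefficients of the structure equations of a holomorphic frame are holomorphic. -/
theorem FrameODE.differentiableOn {V : Set ℂ} (hV : IsOpen V) {P : ℂ → Sp2C} {α β γ θ : ℂ → ℂ}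
    (hP : FrameODE V P α β γ θ) (i j : Idx) :
    DifferentiableOn ℂ (fun x => adaptedForm (α x) (β x) (γ x) (θ x) i j) V := by
  have h1 : ∀ x ∈ V, adaptedForm (α x) (β x) (γ x) (θ x) i j =
      ∑ k, (P x).1⁻¹ i k * deriv (fun y => (P y).1 k j) x := fun x hx => by
    have h2 : ((P x).1⁻¹ * ((P x).1 * adaptedForm (α x) (β x) (γ x) (θ x))) i j
        = adaptedForm (α x) (β x) (γ x) (θ x) i j := by
      rw [← Matrix.mul_assoc, Sp2C.inv_mul, Matrix.one_mul]
    rw [← h2, Matrix.mul_apply]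
    exact Finset.sum_congr rfl fun k _ => by rw [(hP x hx k j).deriv]
  refine DifferentiableOn.congr (DifferentiableOn.fun_sum fun k _ => ?_) h1
  refine DifferentiableOn.mul
    (fun x hx => ((hP x hx).inv i k).differentiableAt.differentiableWithinAt) ?_
  exact DifferentiableOn.deriv
    (fun x hx => (hP x hx k j).differentiableAt.differentiableWithinAt) hV

theorem mfderiv_tvec {F : ℂ → ℂ} {F' x : ℂ} (h : HasDerivAt F F' x) (c : ℂ) :
    mfderiv 𝓘(ℂ) 𝓘(ℂ) F x (c • tvec x 1) = c * F' := by
  rw [map_smul, mfderiv_eq_fderiv, ← h.deriv]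
  rfl

/-- The coefficient `-6^(-1/3)` of `φ⁴₂` in the Cartan connection. -/
def cartanConst : ℂ := -(((6 : ℝ) ^ (-(1 / 3) : ℝ) : ℝ) : ℂ)

theorem cartanConst_ne_zero : cartanConst ≠ 0 :=
  neg_ne_zero.2 (Complex.ofReal_ne_zero.2 (Real.rpow_pos_of_pos (by norm_num) _).ne')

/-- Flatness of the Cartan connection, in terms of the coefficients `α`, `β`, `θ`. -/
theorem cartanForm_eq_flat_iff {A : S → Sp2C} {p : S} {v : TangentSpace 𝓘(ℂ) p} {c : ℂ} :
    cartanForm A p v = !![0, 0; c, 0] ↔ mcForm A p v i2 i2 = 0 ∧ mcForm A p v i2 i4 = 0 ∧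
      cartanConst * mcForm A p v i4 i2 = c := by
  have h : (((3 / 32 : ℝ) ^ (1 / 3 : ℝ) : ℝ) : ℂ) ≠ 0 :=
    Complex.ofReal_ne_zero.2 (Real.rpow_pos_of_pos (by norm_num) _).ne'
  rw [cartanForm, ← cartanConst]
  constructor
  · intro h1
    have e1 := congrFun (congrFun h1 0) 0
    have e2 := congrFun (congrFun h1 0) 1
    have e3 := congrFun (congrFun h1 1) 0
    simp only [Matrix.of_apply, Matrix.cons_val_zero, Matrix.cons_val_one, Matrix.cons_val',
      Matrix.cons_val_fin_one] at e1 e2 e3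
    exact ⟨e1, (mul_eq_zero.1 e2).resolve_left (neg_ne_zero.2 h), e3⟩
  · rintro ⟨h1, h2, h3⟩
    rw [h1, h2, h3]
    simp

theorem exists_adaptedFrame_of_quarticDiff_ne_zero {f : S → Q3} {p : S}
    {v : TangentSpace 𝓘(ℂ) p} (h : quarticDiff f p v ≠ 0) :
    ∃ U A, p ∈ U ∧ IsAdaptedFrame f U A := by
  rw [quarticDiff] at h
  split_ifs at h with hex
  · exact ⟨_, _, hex.choose_spec⟩
  · exact absurd rfl h

/-- The quartic differential can be computed in every adapted frame. In a local coordinate this is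
the transformation rule `θ' = t² θ`, `γ' = t⁻⁶ γ` for changes of adapted frames. -/
theorem IsAdaptedFrame.quarticDiff_eq [IsManifold 𝓘(ℂ) 1 S]
    {f : S → Q3} {U : Set S} {A : S → Sp2C}
    (hA : IsAdaptedFrame f U A) {p : S} (hp : p ∈ U) (v : TangentSpace 𝓘(ℂ) p) :
    quarticDiff f p v = mcForm A p v i1 i3 * mcForm A p v i4 i2 ^ 3 := by
  have hex : ∃ UA : Set S × (S → Sp2C), p ∈ UA.1 ∧ IsAdaptedFrame f UA.1 UA.2 :=
    ⟨(U, A), hp, hA⟩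
  rw [quarticDiff, dif_pos hex]
  generalize hBdef : hex.choose.2 = B
  generalize hU₀def : hex.choose.1 = U₀
  have hp₀ : p ∈ U₀ := by rw [← hU₀def]; exact hex.choose_spec.1
  have hB : IsAdaptedFrame f U₀ B := by rw [← hU₀def, ← hBdef]; exact hex.choose_spec.2
  set e := chartAt ℂ p with he
  have de : e.MDifferentiable 𝓘(ℂ) 𝓘(ℂ) := mdifferentiable_chart p
  have hps : p ∈ e.source := mem_chart_source ℂ p
  have hlp : e.symm (e p) = p := e.left_inv hps
  set V : Set ℂ := e.target ∩ e.symm ⁻¹' (U ∩ U₀) with hV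
  have hVo : IsOpen V := e.isOpen_inter_preimage_symm (hA.isOpen.inter hB.isOpen)
  have hVd : ∀ x ∈ V, MDifferentiableAt 𝓘(ℂ) 𝓘(ℂ) e.symm x :=
    fun x hx => de.mdifferentiableAt_symm hx.1
  have hxV : e p ∈ V := ⟨e.map_source hps, by
    change e.symm (e p) ∈ U ∩ U₀
    rw [hlp]
    exact ⟨hp, hp₀⟩⟩
  have hQ := hA.frameODE 1 hVd (fun x hx => hx.2.1) (fun _ _ => rfl) (fun _ _ => rfl)
    (fun _ _ => rfl) (fun _ _ => rfl)
  have hP := hB.frameODE 1 hVd (fun x hx => hx.2.2) (fun _ _ => rfl) (fun _ _ => rfl)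
    (fun _ _ => rfl) (fun _ _ => rfl)
  have hinj : ∀ x ∈ V, mfderiv 𝓘(ℂ) 𝓘(ℂ) e.symm x (tvec x 1) ≠ 0 := fun x hx =>
    (map_ne_zero_iff _ (de.symm.mfderiv_injective hx.1)).2 (one_ne_zero (α := ℂ))
  have key := hQ.quartic_eq hVo hP (fun x hx => by
    rw [one_mul, one_mul]
    exact (hB.lift _ hx.2.2).symm.trans (hA.lift _ hx.2.1))
    (fun x hx => hB.pfaff42 _ hx.2.2 _ (hinj x hx)) hxV
  -- both sides are homogeneous of degree four in the tangent vector
  have hsc : ∀ w : TangentSpace 𝓘(ℂ) (e.symm (e p)),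
      mcForm B (e.symm (e p)) w i1 i3 * mcForm B (e.symm (e p)) w i4 i2 ^ 3
      = mcForm A (e.symm (e p)) w i1 i3 * mcForm A (e.symm (e p)) w i4 i2 ^ 3 := fun w => by
    obtain ⟨c, rfl⟩ : ∃ c : ℂ, w = c • mfderiv 𝓘(ℂ) 𝓘(ℂ) e.symm (e p) (tvec (e p) 1) := by
      obtain ⟨w', rfl⟩ := de.symm.mfderiv_surjective (e.map_source hps) w
      obtain ⟨c, rfl⟩ := eq_smul_tvec w'
      exact ⟨c, map_smul _ _ _⟩
    simp only [mcForm_smul, Matrix.smul_apply, smul_eq_mul]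
    linear_combination c ^ 4 * key
  rw [hlp] at hsc
  exact hsc v

theorem quarticDiff_smul [IsManifold 𝓘(ℂ) 1 S]
    {f : S → Q3} {U : Set S} {A : S → Sp2C} (hA : IsAdaptedFrame f U A)
    {p : S} (hp : p ∈ U) (c : ℂ) (v : TangentSpace 𝓘(ℂ) p) :
    quarticDiff f p (c • v) = c ^ 4 * quarticDiff f p v := by
  rw [hA.quarticDiff_eq hp, hA.quarticDiff_eq hp, mcForm_smul]
  simp only [Matrix.smul_apply, smul_eq_mul]
  ring

/-- Near every point of the domain of an adapted frame there are projective charts. -/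
theorem IsAdaptedFrame.exists_projectiveChart [IsManifold 𝓘(ℂ) 1 S]
    {f : S → Q3} {U : Set S} {A : S → Sp2C}
    (hA : IsAdaptedFrame f U A) {p : S} (hp : p ∈ U) :
    ∃ W z, p ∈ W ∧ IsProjectiveChart f W z := by
  set e := chartAt ℂ p with he
  have de : e.MDifferentiable 𝓘(ℂ) 𝓘(ℂ) := mdifferentiable_chart p
  have hps : p ∈ e.source := mem_chart_source ℂ p
  have hlp : e.symm (e p) = p := e.left_inv hps
  obtain ⟨R, hR, hball⟩ : ∃ R > 0, Metric.ball (e p) R ⊆ e.target ∩ e.symm ⁻¹' U := by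
    refine Metric.isOpen_iff.1 (e.isOpen_inter_preimage_symm hA.isOpen) _ ⟨e.map_source hps, ?_⟩
    change e.symm (e p) ∈ U
    rwa [hlp]
  have hd : ∀ x ∈ Metric.ball (e p) R, MDifferentiableAt 𝓘(ℂ) 𝓘(ℂ) e.symm x :=
    fun x hx => de.mdifferentiableAt_symm (hball hx).1
  have hQ := hA.frameODE 1 hd (fun x hx => (hball hx).2) (fun _ _ => rfl) (fun _ _ => rfl)
    (fun _ _ => rfl) (fun _ _ => rfl)
  have hhol := hQ.differentiableOn Metric.isOpen_ball
  have hθ : ∀ x ∈ Metric.ball (e p) R, mcForm A (e.symm x)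
      (mfderiv 𝓘(ℂ) 𝓘(ℂ) e.symm x (tvec x 1)) i4 i2 ≠ 0 := fun x hx =>
    hA.pfaff42 _ (hball hx).2 _
      ((map_ne_zero_iff _ (de.symm.mfderiv_injective (hball hx).1)).2 (one_ne_zero (α := ℂ)))
  obtain ⟨ρ, hρ, hρR, t, u, ζ, ht, hflat, hζ, hinj⟩ := hQ.exists_flat hR (hhol i2 i2)
    (hhol i2 i4) (hhol i4 i2) (hθ _ (Metric.mem_ball_self hR)) cartanConst_ne_zero
  have hb : Metric.ball (e p) ρ ⊆ Metric.ball (e p) R := Metric.ball_subset_ball hρR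
  have hAd := hflat.isAdaptedFrame (f := fun x => f (e.symm x)) Metric.isOpen_ball
    (fun x hx => by
      rw [framePlane_mul_gaugeSp _ (ht x hx), one_mul]
      exact hA.lift _ (hball (hb hx)).2)
    (fun x hx => mul_ne_zero (pow_ne_zero 2 (ht x hx)) (hθ x (hb hx)))
  set W : Set S := e.source ∩ e ⁻¹' Metric.ball (e p) ρ with hW
  have hWo : IsOpen W := e.isOpen_inter_preimage Metric.isOpen_ball
  have hed : ∀ q ∈ W, MDifferentiableAt 𝓘(ℂ) 𝓘(ℂ) e q := fun q hq => de.mdifferentiableAt hq.1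
  have hζd : ∀ q ∈ W, MDifferentiableAt 𝓘(ℂ) 𝓘(ℂ) ζ (e q) := fun q hq =>
    (hζ _ hq.2).differentiableAt.mdifferentiableAt
  have hAd' := hAd.comp (f' := f) (h := e) 1 hWo hed (fun q hq => hq.2)
    (fun q hq => by
      ext1
      change _ = Submodule.map (Matrix.mulVecLin 1) (f (e.symm (e q))).plane
      rw [e.left_inv hq.1, Matrix.mulVecLin_one, Submodule.map_id])
    (fun q hq => de.mfderiv_injective hq.1)
  refine ⟨W, fun q => ζ (e q), ⟨hps, Metric.mem_ball_self hρ⟩, hWo,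
    fun q hq => ((hζd q hq).comp q (hed q hq)).mdifferentiableWithinAt,
    fun q hq q' hq' h => e.injOn hq.1 hq'.1 (hinj hq.2 hq'.2 h), _, hAd', fun q hq v => ?_⟩
  have hmf : mfderiv 𝓘(ℂ) 𝓘(ℂ) (fun q => ζ (e q)) q v
      = mfderiv 𝓘(ℂ) 𝓘(ℂ) ζ (e q) (mfderiv 𝓘(ℂ) 𝓘(ℂ) e q v) := by
    have := mfderiv_comp q (hζd q hq) (hed q hq)
    exact congrArg (fun L => L v) this
  obtain ⟨c, hc⟩ := eq_smul_tvec (mfderiv 𝓘(ℂ) 𝓘(ℂ) e q v)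
  have hmc := mcForm_comp 1 (mdifferentiableAt_entries hAd.toIsSymplecticFrame hq.2) (hed q hq) v
  rw [hc, mcForm_smul, mcForm_eq_of_hasMatDerivAt (hflat _ hq.2)] at hmc
  rw [hc, mfderiv_tvec (hζ _ hq.2)] at hmf
  refine cartanForm_eq_flat_iff.2 ⟨?_, ?_, Eq.trans ?_ hmf.symm⟩ <;> rw [hmc]
  · simp [adaptedForm]
  · simp [adaptedForm]
  · simp only [adaptedForm, Matrix.smul_apply, Matrix.fromBlocks_apply₂₁, Matrix.of_apply,
      Matrix.cons_val_one, Matrix.cons_val_fin_one, smul_eq_mul]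
    ring

theorem IsProjectiveChart.mdifferentiableAt {f : S → Q3} {U : Set S} {z : S → ℂ}
    (hz : IsProjectiveChart f U z) {p : S} (hp : p ∈ U) :
    MDifferentiableAt 𝓘(ℂ) 𝓘(ℂ) z p :=
  (hz.holomorphic p hp).mdifferentiableAt (hz.isOpen.mem_nhds hp)

/-- Projective charts are immersions, because `θ ≠ 0` in adapted frames. -/
theorem IsProjectiveChart.mfderiv_injective {f : S → Q3} {U : Set S} {z : S → ℂ}
    (hz : IsProjectiveChart f U z) {p : S} (hp : p ∈ U) :
    Function.Injective (mfderiv 𝓘(ℂ) 𝓘(ℂ) z p) := by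
  obtain ⟨A, hA, hflat⟩ := hz.flat
  refine (injective_iff_map_eq_zero _).2 fun v hv => ?_
  by_contra hv0
  have h1 := (cartanForm_eq_flat_iff.1 (hflat p hp v)).2.2
  exact mul_ne_zero cartanConst_ne_zero (hA.pfaff42 p hp v hv0) (h1.trans hv)

/-- The structure equations of a flat adapted frame, pulled back by a holomorphic map `φ` from the
plane: `α` and `β` vanish, `θ` is a multiple of the derivative of `z ∘ φ`, and `γ` is determined by
the quartic differential. -/
theorem IsAdaptedFrame.flat_frameODE [IsManifold 𝓘(ℂ) 1 S]
    {f : S → Q3} {U : Set S} {z : S → ℂ} {A : S → Sp2C}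
    (hz : IsProjectiveChart f U z) (hA : IsAdaptedFrame f U A)
    (hflat : ∀ p ∈ U, ∀ v : TangentSpace 𝓘(ℂ) p,
      cartanForm A p v = !![0, 0; (mfderiv 𝓘(ℂ) 𝓘(ℂ) z p v : ℂ), 0])
    (X : Sp2C) {V : Set ℂ} {φ : ℂ → S}
    (hφ : ∀ x ∈ V, MDifferentiableAt 𝓘(ℂ) 𝓘(ℂ) φ x) (hU : ∀ x ∈ V, φ x ∈ U)
    {w' : ℂ → ℂ} (hw : ∀ x ∈ V, HasDerivAt (fun x => z (φ x)) (w' x) x) :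
    ∃ γ : ℂ → ℂ, FrameODE V (fun x => X * A (φ x)) 0 0 γ (fun x => cartanConst⁻¹ * w' x) ∧
      ∀ x ∈ V, quarticDiff f (φ x) (mfderiv 𝓘(ℂ) 𝓘(ℂ) φ x (tvec x 1))
        = γ x * (cartanConst⁻¹ * w' x) ^ 3 := by
  have h1 : ∀ x ∈ V, mfderiv 𝓘(ℂ) 𝓘(ℂ) z (φ x) (mfderiv 𝓘(ℂ) 𝓘(ℂ) φ x (tvec x 1)) = w' x :=
    fun x hx => by
      have h2 := mfderiv_comp x (hz.mdifferentiableAt (hU x hx)) (hφ x hx)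
      have h3 := congrArg (fun L => L (tvec x 1)) h2
      refine Eq.trans h3.symm ?_
      have h4 := mfderiv_tvec (hw x hx) 1
      rw [one_smul, one_mul] at h4
      exact h4
  have h2 := fun x hx => cartanForm_eq_flat_iff.1
    (hflat (φ x) (hU x hx) (mfderiv 𝓘(ℂ) 𝓘(ℂ) φ x (tvec x 1)))
  have h3 : ∀ x ∈ V, cartanConst⁻¹ * w' x
      = mcForm A (φ x) (mfderiv 𝓘(ℂ) 𝓘(ℂ) φ x (tvec x 1)) i4 i2 := fun x hx => by
    rw [← h1 x hx]
    refine (congrArg (cartanConst⁻¹ * ·) (h2 x hx).2.2.symm).trans ?_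
    exact inv_mul_cancel_left₀ cartanConst_ne_zero _
  refine ⟨_, hA.frameODE X hφ hU (fun x hx => (h2 x hx).1.symm) (fun x hx => (h2 x hx).2.1.symm)
    (fun x hx => rfl) h3, fun x hx => ?_⟩
  rw [hA.quarticDiff_eq (hU x hx), h3 x hx]

/-- The inverse of a projective chart. -/
theorem IsProjectiveChart.exists_parametrization [IsManifold 𝓘(ℂ) 1 S]
    {f : S → Q3} {U : Set S} {z : S → ℂ}
    (hz : IsProjectiveChart f U z) {p : S} (hp : p ∈ U) {N : Set S} (hN : N ∈ 𝓝 p) :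
    ∃ R > 0, ∃ ψ : ℂ → S, ψ (z p) = p ∧
      (∀ x ∈ Metric.ball (z p) R, MDifferentiableAt 𝓘(ℂ) 𝓘(ℂ) ψ x ∧ ψ x ∈ U ∧ ψ x ∈ N ∧
        z (ψ x) = x) ∧
      ∀ᶠ q in 𝓝 p, ψ (z q) = q := by
  obtain ⟨V, σ, hV, hpV, h1, h2, h3⟩ := exists_local_inverse
    (Filter.inter_mem (hz.isOpen.mem_nhds hp) hN) (fun q hq => hz.mdifferentiableAt hq.1)
    (hz.mfderiv_injective hp)
  obtain ⟨R, hR, hb⟩ := Metric.isOpen_iff.1 hV _ hpV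
  exact ⟨R, hR, σ, h1, fun x hx => ⟨(h2 x (hb hx)).1, (h2 x (hb hx)).2.1.1, (h2 x (hb hx)).2.1.2,
    (h2 x (hb hx)).2.2⟩, h3⟩

/-! ### Identity principles -/

/-- The form of the identity principle used on connected Riemann surfaces: an open set which is
locally either everything or discrete. -/
theorem eq_univ_of_eventually_notMem {T : Type*} [TopologicalSpace T] [PreconnectedSpace T]
    {Z : Set T} (hZ : IsOpen Z) (hne : Z.Nonempty)
    (h : ∀ p ∉ Z, ∀ᶠ q in 𝓝[≠] p, q ∉ Z) : Z = Set.univ := by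
  refine IsClopen.eq_univ ⟨⟨isOpen_iff_eventually.2 fun p hp => ?_⟩, hZ⟩ hne
  have := eventually_nhdsWithin_iff.1 (h p hp)
  filter_upwards [this] with q hq
  by_cases hqp : q = p
  · rwa [hqp]
  · exact hq hqp

/-- The coordinate at a point maps punctured neighbourhoods to punctured neighbourhoods. -/
theorem tendsto_chart_nhdsNE (p : S') :
    Filter.Tendsto (chartAt ℂ p) (𝓝[≠] p) (𝓝[≠] (chartAt ℂ p p)) := by
  refine tendsto_nhdsWithin_iff.2 ⟨((chartAt ℂ p).continuousAt
    (mem_chart_source ℂ p)).tendsto.mono_left nhdsWithin_le_nhds, ?_⟩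
  filter_upwards [self_mem_nhdsWithin,
    nhdsWithin_le_nhds ((chartAt ℂ p).open_source.mem_nhds (mem_chart_source ℂ p))] with q h1 h2
  exact fun h3 => h1 ((chartAt ℂ p).injOn h2 (mem_chart_source ℂ p) h3)

/-- A Riemann surface has no isolated points. -/
theorem neBot_nhdsNE (p : S') : (𝓝[≠] p).NeBot := by
  set e := chartAt ℂ p
  have hp : p ∈ e.source := mem_chart_source ℂ p
  have h1 : Filter.Tendsto e.symm (𝓝[≠] (e p)) (𝓝[≠] p) := by
    refine tendsto_nhdsWithin_iff.2 ⟨?_, ?_⟩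
    · have := e.symm.continuousAt (e.map_source hp)
      rw [ContinuousAt, e.left_inv hp] at this
      exact this.mono_left nhdsWithin_le_nhds
    · filter_upwards [self_mem_nhdsWithin,
        nhdsWithin_le_nhds (e.open_target.mem_nhds (e.map_source hp))] with x h1 h2 h3
      refine h1 ?_
      have h4 : e.symm x = p := h3
      change x = e p
      rw [← h4, e.right_inv h2]
  exact h1.neBot

/-- A holomorphic map is either constant near a given point, or an immersion on a punctured
neighbourhood of it. -/
theorem eventually_const_or_immersion [IsManifold 𝓘(ℂ) 1 S] [IsManifold 𝓘(ℂ) 1 S']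
    {h : S' → S} (hh : MDifferentiable 𝓘(ℂ) 𝓘(ℂ) h) (p : S') :
    (∀ᶠ q in 𝓝 p, h q = h p) ∨
      ∀ᶠ q in 𝓝[≠] p, Function.Injective (mfderiv 𝓘(ℂ) 𝓘(ℂ) h q) := by
  set e := chartAt ℂ p with he
  set e' := chartAt ℂ (h p) with he'
  have hp : p ∈ e.source := mem_chart_source ℂ p
  have hhp : h p ∈ e'.source := mem_chart_source ℂ (h p)
  have de : e.MDifferentiable 𝓘(ℂ) 𝓘(ℂ) := mdifferentiable_chart p
  have de' : e'.MDifferentiable 𝓘(ℂ) 𝓘(ℂ) := mdifferentiable_chart (h p)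
  set F : ℂ → ℂ := fun x => e' (h (e.symm x)) with hF
  have hlp : e.symm (e p) = p := e.left_inv hp
  have hep : Filter.Tendsto e (𝓝 p) (𝓝 (e p)) := e.continuousAt hp
  have hsymm : Filter.Tendsto e.symm (𝓝 (e p)) (𝓝 p) := by
    have := e.symm.continuousAt (e.map_source hp)
    rwa [ContinuousAt, hlp] at this
  have hsrc : ∀ᶠ q in 𝓝 p, h q ∈ e'.source :=
    hh.continuous.continuousAt (e'.open_source.mem_nhds hhp)
  have hFd : ∀ᶠ x in 𝓝 (e p), MDifferentiableAt 𝓘(ℂ) 𝓘(ℂ) F x := by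
    filter_upwards [e.open_target.mem_nhds (e.map_source hp), hsymm.eventually hsrc]
      with x hx1 hx3
    exact (de'.mdifferentiableAt hx3).comp x ((hh _).comp x (de.mdifferentiableAt_symm hx1))
  have hA : AnalyticAt ℂ F (e p) := Complex.analyticAt_iff_eventually_differentiableAt.2
    (hFd.mono fun x hx => hx.differentiableAt)
  rcases hA.deriv.eventually_eq_zero_or_eventually_ne_zero with h0 | h0
  · left
    obtain ⟨R, hR, hb⟩ := Metric.eventually_nhds_iff_ball.1 (h0.and hFd)
    have hconst : ∀ x ∈ Metric.ball (e p) R, F x = F (e p) := fun x hx =>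
      eq_center_of_hasDerivAt_zero (fun y hy => by
        have := (hb y hy).2.differentiableAt.hasDerivAt
        rwa [(hb y hy).1] at this) hx
    filter_upwards [hep (Metric.ball_mem_nhds _ hR), e.open_source.mem_nhds hp, hsrc]
      with q h1 h2 h3
    have h4 := hconst _ h1
    simp only [hF, e.left_inv h2, hlp] at h4
    exact e'.injOn h3 hhp h4
  · right
    filter_upwards [(tendsto_chart_nhdsNE p).eventually h0,
      nhdsWithin_le_nhds (e.open_source.mem_nhds hp), nhdsWithin_le_nhds hsrc] with q h1 h2 h3
    have hlq : e.symm (e q) = q := e.left_inv h2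
    have d1 : MDifferentiableAt 𝓘(ℂ) 𝓘(ℂ) e.symm (e q) :=
      de.mdifferentiableAt_symm (e.map_source h2)
    have d3 : MDifferentiableAt 𝓘(ℂ) 𝓘(ℂ) e' (h (e.symm (e q))) := by
      rw [hlq]; exact de'.mdifferentiableAt h3
    have hmf : mfderiv 𝓘(ℂ) 𝓘(ℂ) F (e q) = (mfderiv 𝓘(ℂ) 𝓘(ℂ) e' (h (e.symm (e q)))).comp
        ((mfderiv 𝓘(ℂ) 𝓘(ℂ) h (e.symm (e q))).comp (mfderiv 𝓘(ℂ) 𝓘(ℂ) e.symm (e q))) := by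
      rw [← mfderiv_comp (e q) (hh _) d1]
      exact mfderiv_comp (e q) d3 ((hh _).comp (e q) d1)
    have key : Function.Injective (mfderiv 𝓘(ℂ) 𝓘(ℂ) h (e.symm (e q))) := by
      refine injective_of_apply_ne_zero
        (v := mfderiv 𝓘(ℂ) 𝓘(ℂ) e.symm (e q) (tvec (e q) 1)) fun h4 => h1 ?_
      have h5 : mfderiv 𝓘(ℂ) 𝓘(ℂ) F (e q) (tvec (e q) 1) = 0 := by
        rw [hmf]
        exact (congrArg (fun w => mfderiv 𝓘(ℂ) 𝓘(ℂ) e' (h (e.symm (e q))) w) h4).trans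
          (map_zero (mfderiv 𝓘(ℂ) 𝓘(ℂ) e' (h (e.symm (e q)))))
      rw [mfderiv_eq_fderiv] at h5
      exact h5
    rwa [hlq] at key

/-- A nonconstant holomorphic map is an immersion off a discrete closed set. -/
theorem eventually_immersion_of_nonconstant [IsManifold 𝓘(ℂ) 1 S] [IsManifold 𝓘(ℂ) 1 S']
    [PreconnectedSpace S'] {h : S' → S}
    (hh : MDifferentiable 𝓘(ℂ) 𝓘(ℂ) h) (hne : ∃ p q, h p ≠ h q) (p : S') :
    ∀ᶠ q in 𝓝[≠] p, Function.Injective (mfderiv 𝓘(ℂ) 𝓘(ℂ) h q) := by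
  refine (eventually_const_or_immersion hh p).resolve_left fun hp => ?_
  have hZ : {p | ∀ᶠ q in 𝓝 p, h q = h p} = Set.univ := by
    refine eq_univ_of_eventually_notMem (isOpen_iff_eventually.2 fun q hq => ?_) ⟨p, hp⟩
      fun q hq => ?_
    · filter_upwards [hq.eventually_nhds, hq] with r hr1 hr2
      filter_upwards [hr1] with s hs
      rw [hs, hr2]
    · filter_upwards [(eventually_const_or_immersion hh q).resolve_left hq] with r hr hr'
      have h1 : mfderiv 𝓘(ℂ) 𝓘(ℂ) h r = 0 := by
        have h2 : h =ᶠ[𝓝 r] fun _ => h r := hr'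
        rw [h2.mfderiv_eq]
        exact mfderiv_const
      have h2 : (1 : ℂ) = 0 := @hr (1 : ℂ) (0 : ℂ) (by rw [h1]; rfl)
      exact one_ne_zero h2
  obtain ⟨a, b, hab⟩ := hne
  have hlc : IsLocallyConstant h := (IsLocallyConstant.iff_eventually_eq h).2
    fun q => Set.eq_univ_iff_forall.1 hZ q
  exact hab (hlc.apply_eq_of_preconnectedSpace a b)

theorem smul_plane {X A : Sp2C} {P : Q3} (h : P.plane = framePlane A) :
    (X • P).plane = framePlane (X * A) := by
  change P.plane.map _ = _
  rw [h, map_framePlane]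

/-- The identity principle for curves: `f'` and `X • (f ∘ h)` agree near a given point, or they
differ on a punctured neighbourhood of it. -/
theorem eventually_eq_or_eventually_ne [IsManifold 𝓘(ℂ) 1 S'] {f : S → Q3} {f' : S' → Q3}
    (hf : IsIsotropicCurve f) (hf' : IsIsotropicCurve f') {h : S' → S}
    (hh : MDifferentiable 𝓘(ℂ) 𝓘(ℂ) h) (X : Sp2C) (p : S') :
    (∀ᶠ q in 𝓝 p, f' q = X • f (h q)) ∨ ∀ᶠ q in 𝓝[≠] p, f' q ≠ X • f (h q) := by
  obtain ⟨U', A', hp', hA'⟩ := hf'.holomorphic p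
  obtain ⟨U, A, hp, hA⟩ := hf.holomorphic (h p)
  have hiff : ∀ q ∈ U', h q ∈ U → (f' q = X • f (h q) ↔
      ∀ i j, ((A' q).1⁻¹ * (X * A (h q)).1) (Sum.inr i) (Sum.inl j) = 0) := fun q h1 h2 => by
    rw [← framePlane_eq_iff, Q3.ext_iff, smul_plane (hA.lift _ h2), hA'.lift _ h1]
    exact eq_comm
  set e := chartAt ℂ p with he
  have hps : p ∈ e.source := mem_chart_source ℂ p
  have de : e.MDifferentiable 𝓘(ℂ) 𝓘(ℂ) := mdifferentiable_chart p
  have hlp : e.symm (e p) = p := e.left_inv hps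
  have hep : Filter.Tendsto e (𝓝 p) (𝓝 (e p)) := e.continuousAt hps
  have hsymm : Filter.Tendsto e.symm (𝓝 (e p)) (𝓝 p) := by
    have := e.symm.continuousAt (e.map_source hps)
    rwa [ContinuousAt, hlp] at this
  have hU : ∀ᶠ q in 𝓝 p, q ∈ U' ∧ h q ∈ U ∧ q ∈ e.source := by
    filter_upwards [hA'.isOpen.mem_nhds hp', hh.continuous.continuousAt (hA.isOpen.mem_nhds hp),
      e.open_source.mem_nhds hps] with q h1 h2 h3 using ⟨h1, h2, h3⟩
  -- the planes agree where the lower left block of `A'⁻¹ X (A ∘ h)`, which is analytic, vanishes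
  have hG : ∀ i j, AnalyticAt ℂ (fun x => ((A' (e.symm x)).1⁻¹ * (X * A (h (e.symm x))).1) i j)
      (e p) := fun i j => by
    refine Complex.analyticAt_iff_eventually_differentiableAt.2 ?_
    filter_upwards [hsymm.eventually hU, e.open_target.mem_nhds (e.map_source hps)] with x hx1 hx2
    have d1 := de.mdifferentiableAt_symm hx2
    have d2 : MDifferentiableAt 𝓘(ℂ) 𝓘(ℂ) (fun x => h (e.symm x)) x := (hh _).comp x d1
    have h1 := hasMatDerivAt_mcForm (mdifferentiableAt_entries_comp 1
      (mdifferentiableAt_entries hA' hx1.1) d1)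
    have h2 := hasMatDerivAt_mcForm (mdifferentiableAt_entries_comp X
      (h := fun x => h (e.symm x)) (mdifferentiableAt_entries hA hx1.2.1) d2)
    have h3 := (h1.inv.mul h2 i j).differentiableAt
    simpa only [one_mul] using h3
  have hor : (∀ i j, ∀ᶠ x in 𝓝 (e p),
      ((A' (e.symm x)).1⁻¹ * (X * A (h (e.symm x))).1) (Sum.inr i) (Sum.inl j) = 0) ∨
      ∃ i j, ∀ᶠ x in 𝓝[≠] (e p),
      ((A' (e.symm x)).1⁻¹ * (X * A (h (e.symm x))).1) (Sum.inr i) (Sum.inl j) ≠ 0 := by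
    by_contra! hcon
    obtain ⟨⟨i, j, h1⟩, h2⟩ := hcon
    rcases (hG (Sum.inr i) (Sum.inl j)).eventually_eq_zero_or_eventually_ne_zero with h3 | h3
    · exact h1 (h3.mono fun x hx => not_not.2 hx)
    · exact h2 i j h3
  rcases hor with h0 | ⟨i, j, h0⟩
  · left
    have h1 : ∀ᶠ x in 𝓝 (e p), ∀ i j,
        ((A' (e.symm x)).1⁻¹ * (X * A (h (e.symm x))).1) (Sum.inr i) (Sum.inl j) = 0 :=
      Filter.eventually_all.2 fun i => Filter.eventually_all.2 fun j => h0 i j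
    filter_upwards [hep.eventually h1, hU] with q hq1 hq2
    rw [e.left_inv hq2.2.2] at hq1
    exact (hiff q hq2.1 hq2.2.1).2 hq1
  · right
    filter_upwards [(tendsto_chart_nhdsNE p).eventually h0, nhdsWithin_le_nhds hU] with q hq1 hq2
    rw [e.left_inv hq2.2.2] at hq1
    exact fun h3 => hq1 ((hiff q hq2.1 hq2.2.1).1 h3 i j)

theorem eq_of_eventually_eq [IsManifold 𝓘(ℂ) 1 S'] [PreconnectedSpace S']
    {f : S → Q3} {f' : S' → Q3}
    (hf : IsIsotropicCurve f) (hf' : IsIsotropicCurve f') {h : S' → S}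
    (hh : MDifferentiable 𝓘(ℂ) 𝓘(ℂ) h) (X : Sp2C) {p : S'}
    (hp : ∀ᶠ q in 𝓝 p, f' q = X • f (h q)) (q : S') : f' q = X • f (h q) := by
  have hZ : {p | ∀ᶠ q in 𝓝 p, f' q = X • f (h q)} = Set.univ := by
    refine eq_univ_of_eventually_notMem (isOpen_iff_eventually.2 fun q hq => hq.eventually_nhds)
      ⟨p, hp⟩ fun q hq => ?_
    filter_upwards [(eventually_eq_or_eventually_ne hf hf' hh X q).resolve_left hq] with r hr hr'
    exact hr hr'.self_of_nhds
  exact (Set.eq_univ_iff_forall.1 hZ q).self_of_nhds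

/-! ### Domination and projective maps -/

variable [IsManifold 𝓘(ℂ) 1 S] [IsManifold 𝓘(ℂ) 1 S']

theorem inv_smul_smul_Q3 (X : Sp2C) (P : Q3) : X⁻¹ • X • P = P := by
  ext1
  change Submodule.map _ (Submodule.map _ P.plane) = _
  rw [← Submodule.map_comp, ← Matrix.mulVecLin_mul]
  have : (X⁻¹).1 * X.1 = 1 := congrArg Subtype.val (inv_mul_cancel X)
  rw [this, Matrix.mulVecLin_one, Submodule.map_id]

/-- A holomorphic map `h` with `f' = X • (f ∘ h)` is projective: in the coordinate of a projective
chart of `f'`, flat adapted frames of `f'` and of `f` (pulled back by `h`) are two frames along the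
same curve. -/
theorem isProjectiveMap_of_dominated {f : S → Q3} {f' : S' → Q3} {h : S' → S}
    (hh : MDifferentiable 𝓘(ℂ) 𝓘(ℂ) h) {X : Sp2C} (hX : ∀ p, f' p = X • f (h p)) :
    IsProjectiveMap f' f h := by
  refine ⟨hh, fun U' z' U z hz' hz p hp' hp => ?_⟩
  obtain ⟨A', hA', hflat'⟩ := hz'.flat
  obtain ⟨A, hA, hflat⟩ := hz.flat
  obtain ⟨R, hR, ψ, -, hψ, hψ'⟩ := hz'.exists_parametrization hp'
    (hh.continuous.continuousAt (hz.isOpen.mem_nhds hp))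
  have dψ : ∀ x ∈ Metric.ball (z' p) R, MDifferentiableAt 𝓘(ℂ) 𝓘(ℂ) (fun x => h (ψ x)) x :=
    fun x hx => (hh _).comp x (hψ x hx).1
  have hw : ∀ x ∈ Metric.ball (z' p) R, HasDerivAt (fun x => z (h (ψ x)))
      (deriv (fun x => z (h (ψ x))) x) x := fun x hx => by
    have h1 : MDifferentiableAt 𝓘(ℂ) 𝓘(ℂ) (fun x => z (h (ψ x))) x :=
      (hz.mdifferentiableAt (hψ x hx).2.2.1).comp x (dψ x hx)
    exact h1.differentiableAt.hasDerivAt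
  have hid : ∀ x ∈ Metric.ball (z' p) R, HasDerivAt (fun x => z' (ψ x)) 1 x := fun x hx =>
    (hasDerivAt_id x).congr_of_eventuallyEq (Filter.eventually_of_mem
      (Metric.isOpen_ball.mem_nhds hx) fun y hy => (hψ y hy).2.2.2)
  obtain ⟨γ, hQ, -⟩ := hA.flat_frameODE hz hflat X dψ (fun x hx => (hψ x hx).2.2.1) hw
  obtain ⟨γ', hP, -⟩ := hA'.flat_frameODE hz' hflat' 1 (fun x hx => (hψ x hx).1)
    (fun x hx => (hψ x hx).2.1) hid
  simp only [mul_one] at hP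
  obtain ⟨a, b, c, d, hdet, hm⟩ := hQ.moebius hR (inv_ne_zero cartanConst_ne_zero) hP
    (fun x hx => by
      have h1 := hX (ψ x)
      rw [Q3.ext_iff, smul_plane (hA.lift _ (hψ x hx).2.2.1), hA'.lift _ (hψ x hx).2.1] at h1
      rw [one_mul]
      exact h1) hw
  refine ⟨a, b, c, d, hdet, ?_⟩
  filter_upwards [hψ', (hz'.mdifferentiableAt hp').continuousAt (Metric.ball_mem_nhds _ hR)]
    with q hq1 hq2
  have h1 := hm _ hq2
  rwa [hq1] at h1

/-- The quartic differential is natural under immersions. An immersion is locally invertible, so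
`f'` has an adapted frame near `p` exactly if `f` has one near `h p`; otherwise both quartic
differentials have the value `0` by convention. -/
theorem quarticDiff_eq_of_dominated {f : S → Q3} {f' : S' → Q3} {h : S' → S}
    (hh : MDifferentiable 𝓘(ℂ) 𝓘(ℂ) h) {X : Sp2C} (hX : ∀ p, f' p = X • f (h p))
    {p : S'} (hp : Function.Injective (mfderiv 𝓘(ℂ) 𝓘(ℂ) h p)) (v : TangentSpace 𝓘(ℂ) p) :
    pullbackQuarticDiff f h p v = quarticDiff f' p v := by
  have hinj := eventually_injective_mfderiv Filter.univ_mem (fun q _ => hh q) hp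
  by_cases hex : ∃ UA : Set S × (S → Sp2C), h p ∈ UA.1 ∧ IsAdaptedFrame f UA.1 UA.2
  · obtain ⟨⟨U, A⟩, hpU, hA⟩ := hex
    obtain ⟨W, hW, hWo, hpW⟩ := eventually_nhds_iff.1 hinj
    have hB := hA.comp X (hWo.inter (hA.isOpen.preimage hh.continuous)) (fun q _ => hh q)
      (fun q hq => hq.2) (fun q _ => hX q) (fun q hq => hW q hq.1)
    rw [hB.quarticDiff_eq ⟨hpW, hpU⟩, mcForm_comp X
      (mdifferentiableAt_entries hA.toIsSymplecticFrame hpU) (hh p)]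
    exact hA.quarticDiff_eq hpU _
  · have hex' : ¬ ∃ UA : Set S' × (S' → Sp2C), p ∈ UA.1 ∧ IsAdaptedFrame f' UA.1 UA.2 := by
      rintro ⟨⟨U', A'⟩, hpU', hA'⟩
      obtain ⟨V, σ, hV, hpV, hσ, h1, -⟩ := exists_local_inverse
        (Filter.inter_mem (hA'.isOpen.mem_nhds hpU') hinj) (fun q _ => hh q) hp
      refine hex ⟨⟨V, _⟩, hpV, hA'.comp X⁻¹ hV (fun y hy => (h1 y hy).1)
        (fun y hy => (h1 y hy).2.1.1) (fun y hy => ?_) (fun y hy => ?_)⟩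
      · rw [hX, (h1 y hy).2.2, inv_smul_smul_Q3]
      · refine injective_mfderiv_of_leftInverse (h1 y hy).1 (hh _) ?_
        filter_upwards [hV.mem_nhds hy] with q hq using (h1 q hq).2.2
    rw [pullbackQuarticDiff, quarticDiff, quarticDiff, dif_neg hex, dif_neg hex']

/-- The quartic differential does not vanish near a point where it does not vanish. -/
theorem eventually_quarticDiff_ne_zero {f : S → Q3} {p : S}
    {v : TangentSpace 𝓘(ℂ) p} (hv : quarticDiff f p v ≠ 0) :
    ∀ᶠ q in 𝓝 p, ∃ w, quarticDiff f q w ≠ 0 := by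
  obtain ⟨U, A, hp, hA⟩ := exists_adaptedFrame_of_quarticDiff_ne_zero hv
  obtain ⟨W, z, hpW, hz⟩ := hA.exists_projectiveChart hp
  obtain ⟨B, hB, hflat⟩ := hz.flat
  obtain ⟨R, hR, ψ, hψp, hψ, hψ'⟩ := hz.exists_parametrization hpW Filter.univ_mem
  have hid : ∀ x ∈ Metric.ball (z p) R, HasDerivAt (fun x => z (ψ x)) 1 x := fun x hx =>
    (hasDerivAt_id x).congr_of_eventuallyEq (Filter.eventually_of_mem
      (Metric.isOpen_ball.mem_nhds hx) fun y hy => (hψ y hy).2.2.2)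
  obtain ⟨γ, hP, hγ⟩ := hB.flat_frameODE hz hflat 1 (fun x hx => (hψ x hx).1)
    (fun x hx => (hψ x hx).2.1) hid
  have hzp : z p ∈ Metric.ball (z p) R := Metric.mem_ball_self hR
  have hγp : γ (z p) ≠ 0 := fun h0 => by
    have h1 := hγ _ hzp
    rw [h0, zero_mul] at h1
    have h2 : ∀ w : TangentSpace 𝓘(ℂ) (ψ (z p)), quarticDiff f (ψ (z p)) w = 0 := fun w => by
      have hs : mfderiv 𝓘(ℂ) 𝓘(ℂ) ψ (z p) (tvec (z p) 1) ≠ 0 := by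
        refine (map_ne_zero_iff _ (injective_mfderiv_of_leftInverse (σ := z) (hψ _ hzp).1
          (hz.mdifferentiableAt (hψ _ hzp).2.1) ?_)).2 (one_ne_zero (α := ℂ))
        filter_upwards [Metric.isOpen_ball.mem_nhds hzp] with y hy using (hψ y hy).2.2.2
      obtain ⟨c, rfl⟩ : ∃ c : ℂ, w = c • mfderiv 𝓘(ℂ) 𝓘(ℂ) ψ (z p) (tvec (z p) 1) :=
        ⟨HDiv.hDiv (α := ℂ) (β := ℂ) w (mfderiv 𝓘(ℂ) 𝓘(ℂ) ψ (z p) (tvec (z p) 1)),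
          (div_mul_cancel₀ (G₀ := ℂ) w hs).symm⟩
      rw [quarticDiff_smul hB (hψ _ hzp).2.1, h1, mul_zero]
    rw [hψp] at h2
    exact hv (h2 v)
  have hcont : ContinuousAt γ (z p) := by
    have := hP.differentiableOn Metric.isOpen_ball i1 i3
    exact ((this _ hzp).differentiableAt (Metric.isOpen_ball.mem_nhds hzp)).continuousAt
  have hz' := (hz.mdifferentiableAt hpW).continuousAt
  filter_upwards [hψ', hz' (Metric.ball_mem_nhds _ hR), hz'.eventually (hcont.eventually_ne hγp)]
    with q hq1 hq2 hq3
  have h1 := hγ _ hq2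
  rw [← hq1]
  refine ⟨mfderiv 𝓘(ℂ) 𝓘(ℂ) ψ (z q) (tvec (z q) 1), ?_⟩
  rw [h1, mul_one]
  exact mul_ne_zero hq3 (pow_ne_zero 3 (inv_ne_zero cartanConst_ne_zero))

/-- A projective map with `h^* δ = δ'` near a point at which `δ'` does not vanish realizes, near
that point, a congruence between `f'` and `f ∘ h`. Since `δ` cannot vanish at `h p` either, there
are projective charts at both points. -/
theorem eventually_congruent {f : S → Q3} {f' : S' → Q3} {h : S' → S}
    (hproj : IsProjectiveMap f' f h) {p : S'}
    (hδ : ∀ᶠ q in 𝓝 p, ∀ v : TangentSpace 𝓘(ℂ) q,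
      pullbackQuarticDiff f h q v = quarticDiff f' q v)
    {v : TangentSpace 𝓘(ℂ) p} (hv : quarticDiff f' p v ≠ 0) :
    ∃ X : Sp2C, ∀ᶠ q in 𝓝 p, f' q = X • f (h q) := by
  have hh := hproj.holomorphic
  have hv' : quarticDiff f (h p) (mfderiv 𝓘(ℂ) 𝓘(ℂ) h p v) ≠ 0 := by
    have := hδ.self_of_nhds v
    rw [pullbackQuarticDiff] at this
    rwa [this]
  obtain ⟨U₁, B', hp₁, hB'⟩ := exists_adaptedFrame_of_quarticDiff_ne_zero hv
  obtain ⟨U₂, B, hp₂, hB⟩ := exists_adaptedFrame_of_quarticDiff_ne_zero hv'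
  obtain ⟨U', z', hp', hz'⟩ := hB'.exists_projectiveChart hp₁
  obtain ⟨U, z, hp, hz⟩ := hB.exists_projectiveChart hp₂
  obtain ⟨A', hA', hflat'⟩ := hz'.flat
  obtain ⟨A, hA, hflat⟩ := hz.flat
  obtain ⟨a, b, c, d, hdet, hm⟩ := hproj.moebius U' z' U z hz' hz p hp' hp
  obtain ⟨R, hR, ψ, -, hψ, hψ'⟩ := hz'.exists_parametrization hp'
    (Filter.inter_mem (Filter.inter_mem (hh.continuous.continuousAt (hz.isOpen.mem_nhds hp)) hδ) hm)
  have dψ : ∀ x ∈ Metric.ball (z' p) R, MDifferentiableAt 𝓘(ℂ) 𝓘(ℂ) (fun x => h (ψ x)) x :=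
    fun x hx => (hh _).comp x (hψ x hx).1
  have hw : ∀ x ∈ Metric.ball (z' p) R, HasDerivAt (fun x => z (h (ψ x)))
      (deriv (fun x => z (h (ψ x))) x) x := fun x hx => by
    have h1 : MDifferentiableAt 𝓘(ℂ) 𝓘(ℂ) (fun x => z (h (ψ x))) x :=
      (hz.mdifferentiableAt (hψ x hx).2.2.1.1.1).comp x (dψ x hx)
    exact h1.differentiableAt.hasDerivAt
  have hid : ∀ x ∈ Metric.ball (z' p) R, HasDerivAt (fun x => z' (ψ x)) 1 x := fun x hx =>
    (hasDerivAt_id x).congr_of_eventuallyEq (Filter.eventually_of_mem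
      (Metric.isOpen_ball.mem_nhds hx) fun y hy => (hψ y hy).2.2.2)
  obtain ⟨γ, hQ, hγ⟩ := hA.flat_frameODE hz hflat 1 dψ (fun x hx => (hψ x hx).2.2.1.1.1) hw
  obtain ⟨γ', hP, hγ'⟩ := hA'.flat_frameODE hz' hflat' 1 (fun x hx => (hψ x hx).1)
    (fun x hx => (hψ x hx).2.1) hid
  simp only [mul_one] at hP hγ'
  obtain ⟨X, hX⟩ := hQ.congruent (inv_ne_zero cartanConst_ne_zero) hP hw hdet
    (fun x hx => by
      have h1 : _ ∧ z (h (ψ x)) = _ := (hψ x hx).2.2.1.2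
      rwa [(hψ x hx).2.2.2] at h1)
    (fun x hx => by
      have h1 : ∀ v : TangentSpace 𝓘(ℂ) (ψ x), pullbackQuarticDiff f h (ψ x) v
        = quarticDiff f' (ψ x) v := (hψ x hx).2.2.1.1.2
      rw [← hγ x hx, ← hγ' x hx, ← h1, pullbackQuarticDiff]
      congr 1
      have h2 := mfderiv_comp x (hh (ψ x)) (hψ x hx).1
      exact congrArg (fun L => L (tvec x 1)) h2.symm)
  refine ⟨X, ?_⟩
  filter_upwards [hψ', (hz'.mdifferentiableAt hp').continuousAt (Metric.ball_mem_nhds _ hR)]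
    with q hq1 hq2
  have h1 := hX _ hq2
  have h2 := hψ _ hq2
  rw [hq1] at h1 h2
  rw [one_mul, one_mul] at h1
  rw [Q3.ext_iff, smul_plane (hA.lift _ h2.2.2.1.1.1), hA'.lift _ h2.2.1]
  exact h1

end IsotropicCurves

end

theorem mainTheorem8
    {S : Type*} [TopologicalSpace S] [T2Space S] [ConnectedSpace S] [ChartedSpace ℂ S]
    [IsManifold 𝓘(ℂ) ω S]
    {S' : Type*} [TopologicalSpace S'] [T2Space S'] [ConnectedSpace S'] [ChartedSpace ℂ S']
    [IsManifold 𝓘(ℂ) ω S']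
    (f : S → IsotropicCurves.Q3) (f' : S' → IsotropicCurves.Q3)
    (hf : IsotropicCurves.IsIsotropicCurve f) (hf' : IsotropicCurves.IsIsotropicCurve f')
    (hfg : IsotropicCurves.IsGeneralType f) (hfg' : IsotropicCurves.IsGeneralType f') :
    IsotropicCurves.IsDominatedBy f' f ↔
      ∃ h : S' → S, IsotropicCurves.IsProjectiveMap f' f h ∧
        ∀ᶠ p in Filter.codiscrete S', ∀ v : TangentSpace 𝓘(ℂ) p,
          IsotropicCurves.pullbackQuarticDiff f h p v = IsotropicCurves.quarticDiff f' p v := by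
  have m1 : IsManifold 𝓘(ℂ) 1 S := IsManifold.of_le (n := ω) le_top
  have m2 : IsManifold 𝓘(ℂ) 1 S' := IsManifold.of_le (n := ω) le_top
  constructor
  · rintro ⟨h, hh, X, hX⟩
    refine ⟨h, IsotropicCurves.isProjectiveMap_of_dominated hh hX, ?_⟩
    have hne : ∃ p q, h p ≠ h q := by
      obtain ⟨p, q, hpq⟩ := hf'.nonconstant
      exact ⟨p, q, fun h0 => hpq (by rw [hX, hX, h0])⟩
    have himm : ∀ᶠ p in Filter.codiscrete S', Function.Injective (mfderiv 𝓘(ℂ) 𝓘(ℂ) h p) := by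
      refine mem_codiscrete.2 fun p => Filter.disjoint_principal_right.2 ?_
      rw [compl_compl]
      exact IsotropicCurves.eventually_immersion_of_nonconstant hh hne p
    filter_upwards [himm] with p hp v
    exact IsotropicCurves.quarticDiff_eq_of_dominated hh hX hp v
  · rintro ⟨h, hproj, hδ⟩
    -- a point, near a point with `δ' ≠ 0`, in a neighbourhood of which `h^* δ = δ'` holds
    obtain ⟨p₀, v₀, hv₀⟩ := hfg'
    have hδ₀ : ∀ᶠ p in 𝓝[≠] p₀, ∀ v : TangentSpace 𝓘(ℂ) p,
        IsotropicCurves.pullbackQuarticDiff f h p v = IsotropicCurves.quarticDiff f' p v := by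
      have := Filter.disjoint_principal_right.1 (mem_codiscrete.1 hδ p₀)
      rwa [compl_compl] at this
    have := IsotropicCurves.neBot_nhdsNE p₀
    obtain ⟨p, ⟨hδp, v, hv⟩, hp⟩ := ((eventually_eventually_nhdsWithin.2 hδ₀).and
      (nhdsWithin_le_nhds (IsotropicCurves.eventually_quarticDiff_ne_zero hv₀))).and
        self_mem_nhdsWithin |>.exists
    rw [isOpen_compl_singleton.nhdsWithin_eq hp] at hδp
    obtain ⟨X, hX⟩ := IsotropicCurves.eventually_congruent hproj hδp hv
    exact ⟨h, hproj.holomorphic, X,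
      IsotropicCurves.eq_of_eventually_eq hf hf' hproj.holomorphic X hX⟩
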